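/- Let $k=\mathbb{F}_q$ be a finite field of characteristic $2$, $\mathbb{Z}_q=W(k)$ its ring of Witt vectors (the ring of integers of the unramified extension $\mathbb{Q}_q$ of $\mathbb{Q}_2$ with residue field $\mathbb{F}_q$) and $\sigma$ the Frobenius automorphism of $\mathbb{Z}_q$ and $\mathbb{Q}_q$. Let $g\ge 1$, let $c\in\mathbb{Z}_q^\times$, let $h_1,\dots,h_m,Q_f\in\mathbb{Z}_q[\Gamma][X]$ ($m\geq 0$) be monic in $X$, let $r_1,\dots,r_m\ge 1$ be integers, and put $$H=\prod_i h_i,\qquad h=c\prod_i h_i^{r_i},\qquad f=HQ_f,\qquad r(\Gamma)=\mathrm{Res}_X\Bigl(H,\;Q_f\tfrac{\partial H}{\partial X}\Bigr)$$ (with $r=1$ if $H=1$). Assume $\deg_X f=2g+1$, $\deg_X h\le g$ and $r(0)\not\equiv 0 \bmod 2$. Let $T^\circ$ be the ($2$-adic, Monsky--Washnitzer) weak completion of $$A=\mathbb{Z}_q\Bigl[\Gamma,X,Y,\tfrac1{r(\Gamma)},\tfrac1{H(X,\Gamma)}\Bigr]\Big/(Y^2+hY-f),$$ that is, the ring of those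 elements of the $2$-adic completion of $A$ that are of the form $\sum_{j\ge 0}2^j p_j(\Gamma,X,Y,1/r,1/H)$ with polynomials $p_j$ over $\mathbb{Z}_q$ of total degree at most $C(j+1)$ for some constant $C$. Let $T=T^\circ[1/2]$, i.e. $$T=\mathbb{Q}_q\Bigl[\Gamma,X,Y,\tfrac1r,\tfrac1H\Bigr]^\dagger\Big/(Y^2+hY-f).$$ Let $d:T\to T\,dX$ be the differential $t\mapsto\frac{\partial t}{\partial X}dX$, where $\partial/\partial X$ is the derivation of $T$ obtained from the unique $\mathbb{Z}_q$-linear derivation of $T^\circ$ with $\Gamma\mapsto 0$ and $X\mapsto 1$; a form in $T\,dX$ is exact if it lies in $dT$. Put $H_{MW}=T\,dX/dT$. Let $\imath$ be the hyperelliptic involution of $T$, $\Gamma\mapsto\Gamma$, $X\mapsto X$, $Y\mapsto -Y-h(X,\Gamma)$, acting on $T\,dX$ by $\imath(t\,dX)=\imath(t)\,dX$ and hence on $H_{MW}$, and let $H_{MW}^-$ be its eigenspace in $H_{MW}$ for the eigenvalue $-1$. Let $F_2:T\to T$ be the lift of Frobenius obtained from the unique ring endomorphism of $T^\circ$ that is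 $\sigma$ on $\mathbb{Z}_q$, sends $\Gamma\mapsto\Gamma^2$ and $X\mapsto X^2$, and satisfies $F_2(Y)\equiv Y^2\bmod 2T^\circ$ (so that $F_2(Y)^2+h^\sigma F_2(Y)-f^\sigma=0$, where $h^\sigma=F_2(h)$ and $f^\sigma=F_2(f)$); it is extended to $T\,dX$ by $F_2(t\,dX)=F_2(t)\cdot 2X\,dX$. Then the form $\imath(F_2(Y\,dX))+F_2(Y\,dX)$ is exact. Moreover $F_2$ on $T\,dX$ induces a well-defined $\sigma$-semilinear map $H_{MW}\to H_{MW}$, and this map sends $H_{MW}^-$ into $H_{MW}^-$. -/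

import Mathlib

noncomputable section

namespace MonskyWashnitzer

section WeakCompletion

variable {R A : Type*} [CommRing R] [CommRing A] [Algebra R A] {n : ℕ}

/-- The `2`-adic completion of a commutative ring. -/
abbrev TwoAdic (A : Type*) [CommRing A] : Type _ := AdicCompletion (Ideal.span {(2 : A)}) A

/-- Power series in one variable `t` with coefficients `f_j ∈ R[x₁, …, x_n]` such that
`deg f_j ≤ c (j + 1)` for some constant `c`. -/
def overconvergent (R : Type*) [CommRing R] (n : ℕ) :
    Subalgebra R (PowerSeries (MvPolynomial (Fin n) R)) where
  carrier := {f | ∃ c : ℕ, ∀ j, (PowerSeries.coeff j f).totalDegree ≤ c * (j + 1)}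
  add_mem' := by
    rintro f g ⟨c, hc⟩ ⟨d, hd⟩
    refine ⟨c + d, fun j => ?_⟩
    rw [map_add]
    refine (MvPolynomial.totalDegree_add _ _).trans (max_le ?_ ?_)
    · nlinarith [hc j]
    · nlinarith [hd j]
  mul_mem' := by
    rintro f g ⟨c, hc⟩ ⟨d, hd⟩
    refine ⟨c + d, fun j => ?_⟩
    rw [PowerSeries.coeff_mul]
    refine MvPolynomial.totalDegree_finsetSum_le fun p hp => ?_
    have hp' := Finset.HasAntidiagonal.mem_antidiagonal.1 hp
    refine (MvPolynomial.totalDegree_mul _ _).trans ?_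
    have h1 : c * (p.1 + 1) ≤ c * (j + 1) := Nat.mul_le_mul_left _ (by omega)
    have h2 : d * (p.2 + 1) ≤ d * (j + 1) := Nat.mul_le_mul_left _ (by omega)
    have := hc p.1
    have := hd p.2
    rw [add_mul]
    omega
  algebraMap_mem' r := by
    refine ⟨0, fun j => ?_⟩
    rw [IsScalarTower.algebraMap_apply R (MvPolynomial (Fin n) R), MvPolynomial.algebraMap_eq]
    change (PowerSeries.coeff j (PowerSeries.C (MvPolynomial.C r))).totalDegree ≤ _
    rw [PowerSeries.coeff_C]
    split_ifs <;> simp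

/-- The partial sums `∑_{j < m} 2 ^ j f_j(x₁, …, x_n)`, as a ring homomorphism to `A / 2 ^ m`. -/
def partialSum (x : Fin n → A) (m : ℕ) :
    PowerSeries (MvPolynomial (Fin n) R) →+* A ⧸ (Ideal.span {(2 : A)}) ^ m where
  toFun f := Ideal.Quotient.mk _
    (∑ j ∈ Finset.range m, 2 ^ j * MvPolynomial.aeval x (PowerSeries.coeff j f))
  map_zero' := by simp
  map_one' := by
    rcases m with _ | m
    · rw [← map_one (Ideal.Quotient.mk _), Ideal.Quotient.eq]
      simp
    · rw [Finset.sum_range_succ']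
      simp [PowerSeries.coeff_one]
  map_add' f g := by
    simp [mul_add, Finset.sum_add_distrib]
  map_mul' f g := by
    rw [← map_mul, Ideal.Quotient.eq, Ideal.span_singleton_pow, Ideal.mem_span_singleton]
    let P : PowerSeries (MvPolynomial (Fin n) R) → Polynomial A := fun f =>
      ∑ j ∈ Finset.range m, Polynomial.C (MvPolynomial.aeval x (PowerSeries.coeff j f)) *
        Polynomial.X ^ j
    have hP : ∀ f, (∑ j ∈ Finset.range m,
        2 ^ j * MvPolynomial.aeval x (PowerSeries.coeff j f)) = (P f).eval 2 := by
      intro f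
      simp only [P, Polynomial.eval_finsetSum, Polynomial.eval_mul, Polynomial.eval_C,
        Polynomial.eval_pow, Polynomial.eval_X]
      exact Finset.sum_congr rfl fun j _ => mul_comm _ _
    have hc : ∀ f j, j < m →
        (P f).coeff j = MvPolynomial.aeval x (PowerSeries.coeff j f) := by
      intro f j hj
      simp only [P, Polynomial.finsetSum_coeff, Polynomial.coeff_C_mul_X_pow]
      rw [Finset.sum_ite_eq, if_pos (Finset.mem_range.2 hj)]
    have hd : (Polynomial.X : Polynomial A) ^ m ∣ P (f * g) - P f * P g := by
      rw [Polynomial.X_pow_dvd_iff]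
      intro d hd
      rw [Polynomial.coeff_sub, hc _ _ hd, Polynomial.coeff_mul, PowerSeries.coeff_mul, map_sum,
        sub_eq_zero]
      refine Finset.sum_congr rfl fun p hp => ?_
      have hp' := Finset.HasAntidiagonal.mem_antidiagonal.1 hp
      rw [hc _ _ (by omega), hc _ _ (by omega), map_mul]
    rw [hP, hP, hP, ← Polynomial.eval_mul, ← Polynomial.eval_sub]
    obtain ⟨q, hq⟩ := hd
    exact ⟨q.eval 2, by rw [hq]; simp⟩

theorem partialSum_compat (x : Fin n → A) {m k : ℕ} (hmk : m ≤ k) :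
    (Ideal.Quotient.factorPow (Ideal.span {(2 : A)}) hmk).comp (partialSum (R := R) x k) =
      partialSum x m := by
  refine RingHom.ext fun f => ?_
  change Ideal.Quotient.mk _ _ = Ideal.Quotient.mk _ _
  rw [Ideal.Quotient.eq, Ideal.span_singleton_pow, Ideal.mem_span_singleton,
    ← Finset.sum_range_add_sum_Ico _ hmk, add_sub_cancel_left]
  refine Finset.dvd_sum fun j hj => ?_
  exact Dvd.dvd.mul_right (pow_dvd_pow _ (Finset.mem_Ico.1 hj).1) _

theorem partialSum_C (x : Fin n → A) (m : ℕ) (p : MvPolynomial (Fin n) R) :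
    partialSum x m (PowerSeries.C p) = Ideal.Quotient.mk _ (MvPolynomial.aeval x p) := by
  change Ideal.Quotient.mk _ _ = _
  rcases m with _ | m
  · rw [Ideal.Quotient.eq]
    simp
  · rw [Finset.sum_range_succ']
    simp [PowerSeries.coeff_C]

/-- The sum `∑_j 2 ^ j f_j(x₁, …, x_n)` in the `2`-adic completion of `A`, for a power series
`∑_j f_j t ^ j`. -/
def seriesSum (x : Fin n → A) : PowerSeries (MvPolynomial (Fin n) R) →ₐ[R] TwoAdic A :=
  { AdicCompletion.liftRingHom (Ideal.span {(2 : A)}) (partialSum (R := R) x)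
      (partialSum_compat x) with
    commutes' := by
      intro r
      refine AdicCompletion.ext_evalₐ fun m => ?_
      refine (AdicCompletion.evalₐ_liftRingHom _ _ (partialSum_compat x) m _).trans ?_
      rw [AdicCompletion.algebraMap_apply, AdicCompletion.evalₐ_of]
      rw [IsScalarTower.algebraMap_apply R (MvPolynomial (Fin n) R), MvPolynomial.algebraMap_eq]
      refine (partialSum_C x m (MvPolynomial.C r)).trans ?_
      simp }

theorem evalₐ_seriesSum (x : Fin n → A) (m : ℕ) (f : PowerSeries (MvPolynomial (Fin n) R)) :
    AdicCompletion.evalₐ (Ideal.span {(2 : A)}) m (seriesSum x f) = Ideal.Quotient.mk _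
      (∑ j ∈ Finset.range m, 2 ^ j * MvPolynomial.aeval x (PowerSeries.coeff j f)) :=
  AdicCompletion.evalₐ_liftRingHom _ _ (partialSum_compat x) m _

theorem seriesSum_C (x : Fin n → A) (p : MvPolynomial (Fin n) R) :
    seriesSum x (PowerSeries.C p) = algebraMap A (TwoAdic A) (MvPolynomial.aeval x p) := by
  refine AdicCompletion.ext_evalₐ fun m => ?_
  refine (AdicCompletion.evalₐ_liftRingHom _ _ (partialSum_compat x) m _).trans ?_
  rw [AdicCompletion.algebraMap_apply, AdicCompletion.evalₐ_of]
  exact partialSum_C x m p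

theorem seriesSum_X (x : Fin n → A) :
    seriesSum x (PowerSeries.X : PowerSeries (MvPolynomial (Fin n) R)) = 2 := by
  refine AdicCompletion.ext_evalₐ fun m => ?_
  rw [evalₐ_seriesSum, map_ofNat]
  rcases m with _ | _ | m
  · have : Subsingleton (A ⧸ Ideal.span {(2 : A)} ^ 0) := by
      rw [pow_zero, Ideal.one_eq_top]
      infer_instance
    exact Subsingleton.elim _ _
  · rw [← map_ofNat (Ideal.Quotient.mk _), Ideal.Quotient.eq]
    simp [PowerSeries.coeff_X]
  · rw [Finset.sum_eq_single_of_mem 1 (by simp)]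
    · simp only [PowerSeries.coeff_X, if_true, map_one, mul_one, pow_one, map_ofNat]
    · intro b _ hb
      simp [PowerSeries.coeff_X, hb]

/-- The (`2`-adic) weak completion `A^†` of `A`, an `R`-algebra with generators `x₁, …, x_n`:
the elements of the `2`-adic completion of the form `∑_j 2 ^ j f_j(x₁, …, x_n)`, where
the `f_j` are polynomials over `R` with `deg f_j ≤ c (j + 1)` for some `c`. -/
def weakCompletion (R : Type*) [CommRing R] [Algebra R A] (x : Fin n → A) :
    Subalgebra R (TwoAdic A) :=
  (overconvergent R n).map (seriesSum x)

variable (R) in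
/-- The map `R[x₁, …, x_n] → A^†`. -/
def ofPoly (x : Fin n → A) : MvPolynomial (Fin n) R →ₐ[R] weakCompletion R x :=
  MvPolynomial.aeval fun i => ⟨algebraMap A (TwoAdic A) (x i), PowerSeries.C (MvPolynomial.X i),
    ⟨1, fun j => by
      rw [PowerSeries.coeff_C]
      split_ifs
      · exact (MvPolynomial.totalDegree_monomial_le _ _).trans (by simp)
      · simp⟩, (seriesSum_C x (MvPolynomial.X i)).trans (by rw [MvPolynomial.aeval_X])⟩

theorem coe_ofPoly (x : Fin n → A) (p : MvPolynomial (Fin n) R) :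
    (ofPoly R x p : TwoAdic A) = algebraMap A (TwoAdic A) (MvPolynomial.aeval x p) := by
  have : ((weakCompletion R x).val.comp (ofPoly R x)) =
      ((Algebra.ofId A (TwoAdic A)).restrictScalars R).comp (MvPolynomial.aeval x) := by
    ext i
    simp [ofPoly, Algebra.ofId_apply]
  exact DFunLike.congr_fun this p

/-- `A^†` is `2`-adically separated. -/
theorem eq_zero_of_forall_two_pow (x : Fin n → A) (z : weakCompletion R x)
    (hz : ∀ m : ℕ, ∃ w, z = 2 ^ m * w) : z = 0 := by
  refine Subtype.ext (AdicCompletion.ext_evalₐ fun m => ?_)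
  obtain ⟨w, hw⟩ := hz m
  have h2 : (2 : A ⧸ Ideal.span {(2 : A)} ^ m) ^ m = 0 := by
    rw [← map_ofNat (Ideal.Quotient.mk _), ← map_pow, Ideal.Quotient.eq_zero_iff_mem]
    exact Ideal.pow_mem_pow (Ideal.mem_span_singleton_self _) _
  have e2 : AdicCompletion.evalₐ (Ideal.span {(2 : A)}) m
    (((2 : weakCompletion R x) ^ m : weakCompletion R x) : TwoAdic A) = 0 := by
    rw [Subalgebra.coe_pow, map_pow, ← h2]
    congr 1
  rw [hw, Subalgebra.coe_mul, map_mul, e2, zero_mul]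
  simp

/-- The image of `A` is `2`-adically dense in `A^†`. -/
theorem exists_approx (x : Fin n → A) (m : ℕ) (z : weakCompletion R x) :
    ∃ p w, z = ofPoly R x p + 2 ^ m * w := by
  induction m generalizing z with
  | zero => exact ⟨0, z, by simp⟩
  | succ m ih =>
    obtain ⟨p, w, rfl⟩ := ih z
    obtain ⟨w, f, ⟨c, hc⟩, rfl⟩ := w
    refine ⟨p + 2 ^ m * PowerSeries.coeff 0 f,
      ⟨seriesSum x (PowerSeries.mk fun j => PowerSeries.coeff (j + 1) f), _, ⟨2 * c, fun j => ?_⟩,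
        rfl⟩, ?_⟩
    · rw [PowerSeries.coeff_mk]
      exact (hc _).trans (by nlinarith)
    · have h := congrArg (seriesSum x) (PowerSeries.eq_X_mul_shift_add_const f)
      rw [map_add, map_mul, seriesSum_X] at h
      have h' := seriesSum_C x (PowerSeries.coeff 0 f)
      rw [← coe_ofPoly] at h'
      apply Subtype.ext
      simp only [map_add, map_mul, map_pow, map_ofNat, Subalgebra.coe_add, Subalgebra.coe_mul,
        Subalgebra.coe_pow, RingHom.coe_coe] at h h' ⊢
      have e2 : ((2 : weakCompletion R x) : TwoAdic A) = 2 := rfl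
      rw [e2, ← h']
      simp only [PowerSeries.coeff_zero_eq_constantCoeff] at h ⊢
      linear_combination (2 ^ m : TwoAdic A) * h

theorem two_pow_dvd_of_ofPoly (x : Fin n → A) (m : ℕ) (p : MvPolynomial (Fin n) R)
    (w : weakCompletion R x) (h : ofPoly R x p = 2 ^ m * w) :
    ∃ a : A, MvPolynomial.aeval x p = 2 ^ m * a := by
  have h2 : (2 : A ⧸ Ideal.span {(2 : A)} ^ m) ^ m = 0 := by
    rw [← map_ofNat (Ideal.Quotient.mk _), ← map_pow, Ideal.Quotient.eq_zero_iff_mem]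
    exact Ideal.pow_mem_pow (Ideal.mem_span_singleton_self _) _
  have h' := congrArg (fun z : weakCompletion R x =>
    AdicCompletion.evalₐ (Ideal.span {(2 : A)}) m (z : TwoAdic A)) h
  simp only [coe_ofPoly, Subalgebra.coe_mul, map_mul, AdicCompletion.algebraMap_apply] at h'
  erw [AdicCompletion.evalₐ_of] at h'
  have e2 : AdicCompletion.evalₐ (Ideal.span {(2 : A)}) m
    (((2 : weakCompletion R x) ^ m : weakCompletion R x) : TwoAdic A) = 0 := by
    rw [Subalgebra.coe_pow, map_pow, ← h2]
    congr 1
  rw [e2, zero_mul, Ideal.Quotient.eq_zero_iff_mem, Ideal.span_singleton_pow,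
    Ideal.mem_span_singleton] at h'
  exact h'

/-- Extension of additive maps on polynomials to `A^†`. -/
theorem exists_extension (x : Fin n → A)
    (hx : Function.Surjective (MvPolynomial.aeval x : MvPolynomial (Fin n) R →ₐ[R] A))
    (δ : MvPolynomial (Fin n) R →+ weakCompletion R x)
    (hδ : ∀ p, MvPolynomial.aeval x p = 0 → δ p = 0)
    (Δ : MvPolynomial (Fin n) R → PowerSeries (MvPolynomial (Fin n) R))
    (hΔ : ∀ p, seriesSum x (Δ p) = δ p) (c : ℕ)
    (hdeg : ∀ p j, (PowerSeries.coeff j (Δ p)).totalDegree ≤ c * (j + p.totalDegree + 1)) :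
    ∃ E : weakCompletion R x →+ weakCompletion R x,
      ∀ m p w, ∃ w', E (ofPoly R x p + 2 ^ m * w) = δ p + 2 ^ m * w' := by
  have key : ∀ m p w, ofPoly R x p = 2 ^ m * w → ∃ w', δ p = 2 ^ m * w' := by
    intro m p w h
    obtain ⟨a, ha⟩ := two_pow_dvd_of_ofPoly x m p w h
    obtain ⟨q, rfl⟩ := hx a
    have h0 := hδ (p - 2 ^ m • q) (by rw [map_sub, ha]; simp)
    refine ⟨δ q, ?_⟩
    rw [map_sub, sub_eq_zero, map_nsmul] at h0
    rw [h0]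
    simp
  have ex : ∀ z : weakCompletion R x, ∃ y : weakCompletion R x,
      ∀ m p w, z = ofPoly R x p + 2 ^ m * w → ∃ w', y = δ p + 2 ^ m * w' := by
    rintro ⟨_, f, ⟨d, hd⟩, rfl⟩
    have shift : ∀ k : ℕ, ∀ f : PowerSeries (MvPolynomial (Fin n) R),
        (∃ d : ℕ, ∀ j, (PowerSeries.coeff j f).totalDegree ≤ d * (j + 1)) →
        (∃ d : ℕ, ∀ j, (PowerSeries.coeff j (PowerSeries.mk fun j =>
          PowerSeries.coeff (j + k) f)).totalDegree ≤ d * (j + 1)) := by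
      rintro k f ⟨d, hd⟩
      refine ⟨d * (k + 1), fun j => ?_⟩
      rw [PowerSeries.coeff_mk]
      refine (hd _).trans ?_
      rw [mul_assoc]
      exact Nat.mul_le_mul_left _ (by nlinarith)
    let g : PowerSeries (MvPolynomial (Fin n) R) → PowerSeries (MvPolynomial (Fin n) R) :=
      fun f => PowerSeries.mk fun N => ∑ q ∈ Finset.HasAntidiagonal.antidiagonal N,
        PowerSeries.coeff q.2 (Δ (PowerSeries.coeff q.1 f))
    have hg : ∀ f : PowerSeries (MvPolynomial (Fin n) R),
        (∃ d : ℕ, ∀ j, (PowerSeries.coeff j f).totalDegree ≤ d * (j + 1)) →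
        (∃ d : ℕ, ∀ j, (PowerSeries.coeff j (g f)).totalDegree ≤ d * (j + 1)) := by
      rintro f ⟨d, hd⟩
      refine ⟨c * (d + 1), fun j => ?_⟩
      simp only [g, PowerSeries.coeff_mk]
      refine MvPolynomial.totalDegree_finsetSum_le fun q hq => ?_
      have hq' := Finset.HasAntidiagonal.mem_antidiagonal.1 hq
      refine (hdeg _ _).trans ?_
      rw [mul_assoc]
      refine Nat.mul_le_mul_left _ ?_
      have := hd q.1
      have : d * (q.1 + 1) ≤ d * (j + 1) := Nat.mul_le_mul_left _ (by omega)
      rw [add_mul]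
      omega
    have hstep : ∀ f : PowerSeries (MvPolynomial (Fin n) R),
        g f = Δ (PowerSeries.coeff 0 f) +
          PowerSeries.X * g (PowerSeries.mk fun j => PowerSeries.coeff (j + 1) f) := by
      intro f
      ext1 N
      rw [map_add]
      rcases N with _ | N
      · simp [g]
      · rw [PowerSeries.coeff_succ_X_mul]
        simp only [g, PowerSeries.coeff_mk, Finset.Nat.antidiagonal_succ, Finset.sum_cons,
          Finset.sum_map]
        rfl
    have happ : ∀ (m : ℕ) (f : PowerSeries (MvPolynomial (Fin n) R)) (hf : f ∈ overconvergent R n),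
        ∃ (p : MvPolynomial (Fin n) R) (w w' : weakCompletion R x),
          seriesSum x f = ((ofPoly R x p + 2 ^ m * w : weakCompletion R x) : TwoAdic A) ∧
          seriesSum x (g f) = ((δ p + 2 ^ m * w' : weakCompletion R x) : TwoAdic A) := by
      intro m
      induction m with
      | zero =>
        intro f hf
        exact ⟨0, ⟨_, f, hf, rfl⟩, ⟨_, g f, hg f hf, rfl⟩, by simp, by simp⟩
      | succ m ih =>
        intro f hf
        obtain ⟨p, w, w', h1, h2⟩ := ih (PowerSeries.mk fun j => PowerSeries.coeff (j + 1) f)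
          (shift 1 f hf)
        refine ⟨PowerSeries.coeff 0 f + (p + p), w, w', ?_, ?_⟩
        · have h := congrArg (seriesSum x) (PowerSeries.eq_X_mul_shift_add_const f)
          rw [map_add, map_mul, seriesSum_X, h1] at h
          have h' := seriesSum_C x (PowerSeries.coeff 0 f)
          rw [← coe_ofPoly] at h'
          have h4 : seriesSum x f = 2 * ((ofPoly R x p + 2 ^ m * w : weakCompletion R x) :
            TwoAdic A) + ofPoly R x (PowerSeries.coeff 0 f) :=
            h.trans (by rw [← h', PowerSeries.coeff_zero_eq_constantCoeff])
          rw [h4]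
          have e2 : ((2 : weakCompletion R x) : TwoAdic A) = 2 := rfl
          simp only [map_add, Subalgebra.coe_add, Subalgebra.coe_mul, Subalgebra.coe_pow, e2]
          ring
        · have h := congrArg (seriesSum x) (hstep f)
          rw [map_add, map_mul, seriesSum_X, h2, hΔ] at h
          rw [h]
          have e2 : ((2 : weakCompletion R x) : TwoAdic A) = 2 := rfl
          simp only [map_add, Subalgebra.coe_add, Subalgebra.coe_mul, Subalgebra.coe_pow, e2]
          ring
    refine ⟨⟨_, g f, hg f ⟨d, hd⟩, rfl⟩, fun m p w h => ?_⟩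
    obtain ⟨q, v, v', h1, h2⟩ := happ m f ⟨d, hd⟩
    have h3 : ofPoly R x p + 2 ^ m * w = ofPoly R x q + 2 ^ m * v :=
      h.symm.trans (Subtype.ext h1)
    obtain ⟨w', hw'⟩ := key m (q - p) (w - v) (by
      rw [map_sub]
      linear_combination -h3)
    refine ⟨w' + v', ?_⟩
    rw [map_sub] at hw'
    refine (Subtype.ext h2).trans ?_
    linear_combination hw'
  choose E hE using ex
  refine ⟨AddMonoidHom.mk' E ?_, fun m p w => hE _ m p w rfl⟩
  intro a b
  rw [← sub_eq_zero]
  refine eq_zero_of_forall_two_pow x _ fun m => ?_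
  obtain ⟨p, w, hp⟩ := exists_approx x m a
  obtain ⟨q, v, hq⟩ := exists_approx x m b
  obtain ⟨w1, h1⟩ := hE a m p w hp
  obtain ⟨w2, h2⟩ := hE b m q v hq
  obtain ⟨w3, h3⟩ := hE (a + b) m (p + q) (w + v) (by rw [hp, hq, map_add]; ring)
  refine ⟨w3 - w1 - w2, ?_⟩
  rw [h1, h2, h3, map_add]
  ring

/-- Ring endomorphisms of `A^†` are determined by their restriction to polynomials. -/
theorem ringHom_ext_of_ofPoly (x : Fin n → A) {F G : weakCompletion R x →+* weakCompletion R x}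
    (h : ∀ p, F (ofPoly R x p) = G (ofPoly R x p)) : F = G := by
  refine RingHom.ext fun z => ?_
  rw [← sub_eq_zero]
  refine eq_zero_of_forall_two_pow x _ fun m => ?_
  obtain ⟨p, w, rfl⟩ := exists_approx x m z
  refine ⟨F w - G w, ?_⟩
  simp only [map_add, map_mul, map_pow, map_ofNat, h]
  ring

/-- Derivations of `A^†` are determined by their restriction to polynomials. -/
theorem derivation_ext_of_ofPoly (x : Fin n → A)
    {D E : Derivation R (weakCompletion R x) (weakCompletion R x)}
    (h : ∀ p, D (ofPoly R x p) = E (ofPoly R x p)) : D = E := by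
  refine Derivation.ext fun z => ?_
  rw [← sub_eq_zero]
  refine eq_zero_of_forall_two_pow x _ fun m => ?_
  obtain ⟨p, w, rfl⟩ := exists_approx x m z
  refine ⟨D w - E w, ?_⟩
  have e2 : (2 ^ m : weakCompletion R x) = algebraMap R (weakCompletion R x) (2 ^ m) := by
    rw [map_pow, map_ofNat]
  rw [e2, ← Algebra.smul_def, ← Algebra.smul_def, map_add, map_add, Derivation.map_smul,
    Derivation.map_smul, h, smul_sub]
  abel

/-- Extension of ring homomorphisms to `A^†`. -/
theorem exists_ringHom (x : Fin n → A)
    (hx : Function.Surjective (MvPolynomial.aeval x : MvPolynomial (Fin n) R →ₐ[R] A))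
    (ψ : R →+* R) (y : Fin n → weakCompletion R x)
    (hy : ∀ p, MvPolynomial.aeval x p = 0 →
      MvPolynomial.eval₂ ((algebraMap R (weakCompletion R x)).comp ψ) y p = 0) :
    ∃ F : weakCompletion R x →+* weakCompletion R x, ∀ p, F (ofPoly R x p) =
      MvPolynomial.eval₂ ((algebraMap R (weakCompletion R x)).comp ψ) y p := by
  choose g hg hgy using fun i => (y i).2
  choose d hd using hg
  let φ := MvPolynomial.eval₂Hom ((algebraMap R (weakCompletion R x)).comp ψ) y
  let Δ : MvPolynomial (Fin n) R →+* PowerSeries (MvPolynomial (Fin n) R) :=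
    MvPolynomial.eval₂Hom ((algebraMap R (PowerSeries (MvPolynomial (Fin n) R))).comp ψ) g
  let c := ∑ i, d i
  have hdc : ∀ i j, (PowerSeries.coeff j (g i)).totalDegree ≤ c * (j + 1) := fun i j =>
    (hd i j).trans (Nat.mul_le_mul_right _
      (Finset.single_le_sum (fun _ _ => Nat.zero_le _) (Finset.mem_univ i)))
  have hmul : ∀ (u v : PowerSeries (MvPolynomial (Fin n) R)) (a b : ℕ),
      (∀ j, (PowerSeries.coeff j u).totalDegree ≤ c * (j + a)) →
      (∀ j, (PowerSeries.coeff j v).totalDegree ≤ c * (j + b)) →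
      ∀ j, (PowerSeries.coeff j (u * v)).totalDegree ≤ c * (j + (a + b)) := by
    intro u v a b hu hv j
    rw [PowerSeries.coeff_mul]
    refine MvPolynomial.totalDegree_finsetSum_le fun q hq => ?_
    have hq' := Finset.HasAntidiagonal.mem_antidiagonal.1 hq
    refine (MvPolynomial.totalDegree_mul _ _).trans ?_
    have h1 := hu q.1
    have h2 := hv q.2
    have : c * (j + (a + b)) = c * (q.1 + a) + c * (q.2 + b) := by
      rw [← mul_add, ← hq']
      congr 1
      ring
    omega
  have hone : ∀ j, (PowerSeries.coeff j
      (1 : PowerSeries (MvPolynomial (Fin n) R))).totalDegree ≤ c * (j + 0) := by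
    intro j
    rw [PowerSeries.coeff_one]
    split_ifs <;> simp
  have halg : ∀ r : R, ∀ j, (PowerSeries.coeff j
      (algebraMap R (PowerSeries (MvPolynomial (Fin n) R)) r)).totalDegree ≤ c * (j + 0) := by
    intro r j
    rw [IsScalarTower.algebraMap_apply R (MvPolynomial (Fin n) R), MvPolynomial.algebraMap_eq]
    change (PowerSeries.coeff j (PowerSeries.C (MvPolynomial.C r))).totalDegree ≤ _
    rw [PowerSeries.coeff_C]
    split_ifs <;> simp
  have hpow : ∀ i (e : ℕ), ∀ j, (PowerSeries.coeff j (g i ^ e)).totalDegree ≤ c * (j + e) := by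
    intro i e
    induction e with
    | zero => simpa using hone
    | succ e ih =>
      rw [pow_succ]
      exact hmul _ _ _ _ ih (hdc i)
  have hprod : ∀ (s : Fin n →₀ ℕ) (t : Finset (Fin n)), ∀ j,
      (PowerSeries.coeff j (∏ i ∈ t, g i ^ s i)).totalDegree ≤ c * (j + ∑ i ∈ t, s i) := by
    intro s t
    induction t using Finset.induction_on with
    | empty => simpa using hone
    | insert i t hi ih =>
      rw [Finset.prod_insert hi, Finset.sum_insert hi]
      exact hmul _ _ _ _ (hpow i _) ih
  obtain ⟨E, hE⟩ := exists_extension x hx φ.toAddMonoidHom hy Δ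
    (by
      have : (seriesSum x : _ →ₐ[R] TwoAdic A).toRingHom.comp Δ =
          (weakCompletion R x).val.toRingHom.comp φ := by
        refine MvPolynomial.ringHom_ext (fun r => ?_) (fun i => ?_)
        · simp [Δ, φ]
        · simpa [Δ, φ] using hgy i
      exact fun p => DFunLike.congr_fun this p) c (by
      intro p j
      simp only [Δ, MvPolynomial.coe_eval₂Hom]
      rw [MvPolynomial.eval₂_eq', map_sum]
      refine MvPolynomial.totalDegree_finsetSum_le fun s hs => ?_
      refine (hmul _ _ _ _ (halg _) (hprod s Finset.univ) j).trans ?_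
      refine Nat.mul_le_mul_left _ ?_
      have h1 := MvPolynomial.le_totalDegree hs
      rw [Finsupp.sum_fintype _ _ (fun _ => rfl)] at h1
      omega)
  have hE0 : ∀ p, E (ofPoly R x p) = φ p := by
    intro p
    rw [← sub_eq_zero]
    refine eq_zero_of_forall_two_pow x _ fun m => ?_
    obtain ⟨w', h⟩ := hE m p 0
    rw [mul_zero, add_zero] at h
    exact ⟨w', by rw [h]; simp⟩
  refine ⟨{ E with
    map_one' := by
      change E 1 = 1
      have h1 := hE0 1
      rwa [map_one, map_one φ] at h1
    map_mul' := by
      intro a b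
      change E (a * b) = E a * E b
      rw [← sub_eq_zero]
      refine eq_zero_of_forall_two_pow x _ fun m => ?_
      obtain ⟨p, w, hp⟩ := exists_approx x m a
      obtain ⟨q, v, hq⟩ := exists_approx x m b
      obtain ⟨w1, h1⟩ := hE m p w
      obtain ⟨w2, h2⟩ := hE m q v
      obtain ⟨w3, h3⟩ := hE m (p * q) (ofPoly R x p * v + ofPoly R x q * w + 2 ^ m * w * v)
      have e : a * b = ofPoly R x (p * q) +
          2 ^ m * (ofPoly R x p * v + ofPoly R x q * w + 2 ^ m * w * v) := by
        rw [hp, hq, map_mul]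
        ring
      refine ⟨w3 - φ p * w2 - φ q * w1 - 2 ^ m * w1 * w2, ?_⟩
      rw [e, h3, hp, hq, h1, h2]
      change φ (p * q) + _ - (φ p + _) * (φ q + _) = _
      rw [map_mul]
      ring }, fun p => hE0 p⟩

/-- Extension of derivations to `A^†`. -/
theorem exists_derivation (x : Fin n → A)
    (hx : Function.Surjective (MvPolynomial.aeval x : MvPolynomial (Fin n) R →ₐ[R] A))
    (y : Fin n → weakCompletion R x)
    (hy : ∀ p, MvPolynomial.aeval x p = 0 →
      ∑ i, ofPoly R x (MvPolynomial.pderiv i p) * y i = 0) :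
    ∃ D : Derivation R (weakCompletion R x) (weakCompletion R x), ∀ p,
      D (ofPoly R x p) = ∑ i, ofPoly R x (MvPolynomial.pderiv i p) * y i := by
  choose g hg hgy using fun i => (y i).2
  choose d hd using hg
  let c := ∑ i, d i
  have hdc : ∀ i j, (PowerSeries.coeff j (g i)).totalDegree ≤ c * (j + 1) := fun i j =>
    (hd i j).trans (Nat.mul_le_mul_right _
      (Finset.single_le_sum (fun _ _ => Nat.zero_le _) (Finset.mem_univ i)))
  have hpd : ∀ (p : MvPolynomial (Fin n) R) i,
      (MvPolynomial.pderiv i p).totalDegree ≤ p.totalDegree := by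
    intro p i
    conv_lhs => rw [p.as_sum, map_sum]
    refine MvPolynomial.totalDegree_finsetSum_le fun s hs => ?_
    rw [MvPolynomial.pderiv_monomial]
    refine (MvPolynomial.totalDegree_monomial_le _ _).trans ?_
    refine le_trans ?_ (MvPolynomial.le_totalDegree hs)
    rw [Finsupp.sum_fintype _ _ (fun _ => rfl), Finsupp.sum_fintype _ _ (fun _ => rfl)]
    refine Finset.sum_le_sum fun j _ => ?_
    simp
  let δ : MvPolynomial (Fin n) R →ₗ[R] weakCompletion R x :=
    { toFun := fun p => ∑ i, ofPoly R x (MvPolynomial.pderiv i p) * y i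
      map_add' := fun p q => by simp [add_mul, Finset.sum_add_distrib]
      map_smul' := fun r p => by simp [Finset.smul_sum] }
  obtain ⟨E, hE⟩ := exists_extension x hx δ.toAddMonoidHom hy
    (fun p => ∑ i, PowerSeries.C (MvPolynomial.pderiv i p) * g i)
    (by
      intro p
      change _ = ((∑ i, ofPoly R x (MvPolynomial.pderiv i p) * y i : weakCompletion R x) :
        TwoAdic A)
      rw [map_sum, AddSubmonoidClass.coe_finsetSum]
      refine Finset.sum_congr rfl fun i _ => ?_
      have h1 : seriesSum x (g i) = (y i : TwoAdic A) := hgy i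
      rw [map_mul, seriesSum_C, Subalgebra.coe_mul, coe_ofPoly, h1]) (c + 1) (by
      intro p j
      rw [map_sum]
      refine MvPolynomial.totalDegree_finsetSum_le fun i _ => ?_
      rw [PowerSeries.coeff_C_mul]
      refine (MvPolynomial.totalDegree_mul _ _).trans ?_
      have h1 := hpd p i
      have h2 := hdc i j
      have h3 : c * (j + 1) ≤ c * (j + p.totalDegree + 1) := Nat.mul_le_mul_left _ (by omega)
      rw [add_mul]
      omega)
  have hE0 : ∀ p, E (ofPoly R x p) = δ p := by
    intro p
    rw [← sub_eq_zero]
    refine eq_zero_of_forall_two_pow x _ fun m => ?_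
    obtain ⟨w', h⟩ := hE m p 0
    rw [mul_zero, add_zero] at h
    exact ⟨w', by rw [h]; simp⟩
  have hEmul : ∀ a b, E (a * b) = a * E b + b * E a := by
    intro a b
    rw [← sub_eq_zero]
    refine eq_zero_of_forall_two_pow x _ fun m => ?_
    obtain ⟨p, w, hp⟩ := exists_approx x m a
    obtain ⟨q, v, hq⟩ := exists_approx x m b
    obtain ⟨w1, h1⟩ := hE m p w
    obtain ⟨w2, h2⟩ := hE m q v
    obtain ⟨w3, h3⟩ := hE m (p * q) (ofPoly R x p * v + ofPoly R x q * w + 2 ^ m * w * v)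
    have e : a * b = ofPoly R x (p * q) +
        2 ^ m * (ofPoly R x p * v + ofPoly R x q * w + 2 ^ m * w * v) := by
      rw [hp, hq, map_mul]
      ring
    have hδ : δ (p * q) = ofPoly R x p * δ q + ofPoly R x q * δ p := by
      simp only [δ, LinearMap.coe_mk, AddHom.coe_mk, Finset.mul_sum, ← Finset.sum_add_distrib]
      refine Finset.sum_congr rfl fun i _ => ?_
      simp only [Derivation.leibniz, smul_eq_mul, map_add, map_mul]
      ring
    refine ⟨w3 - ofPoly R x p * w2 - ofPoly R x q * w1 - w * δ q - v * δ p -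
      2 ^ m * (w * w2 + v * w1), ?_⟩
    rw [e, h3, hp, hq, h1, h2]
    change δ (p * q) + _ - ((_ + _) * (δ q + _) + (_ + _) * (δ p + _)) = _
    rw [hδ]
    ring
  have hEr : ∀ r : R, E (algebraMap R _ r) = 0 := by
    intro r
    have := hE0 (MvPolynomial.C r)
    rw [← MvPolynomial.algebraMap_eq, AlgHom.commutes] at this
    rw [this]
    simp [δ]
  refine ⟨Derivation.mk' { E with
    map_smul' := by
      intro r a
      change E (r • a) = r • E a
      rw [Algebra.smul_def, hEmul, hEr, mul_zero, add_zero, Algebra.smul_def] } ?_,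
    fun p => hE0 p⟩
  intro a b
  change E (a * b) = a * E b + b * E a
  exact hEmul a b

/-- Coefficients of the power series solution of `v = α + t (β v + γ v ^ 2)`. -/
def rootCoeff {S : Type*} [CommRing S] (α β γ : S) : ℕ → S
  | 0 => α
  | k + 1 => β * rootCoeff α β γ k +
      γ * ∑ i : Fin (k + 1), rootCoeff α β γ i * rootCoeff α β γ (k - i)

/-- The quadratic equation `v = α + 2 (β v + γ v ^ 2)` is solvable in `A^†`. -/
theorem exists_root (x : Fin n → A) (α β γ : MvPolynomial (Fin n) R) :
    ∃ v : weakCompletion R x,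
      v = ofPoly R x α + 2 * (ofPoly R x β * v + ofPoly R x γ * v ^ 2) := by
  let a := rootCoeff α β γ
  let c := α.totalDegree + β.totalDegree + γ.totalDegree
  have ha : ∀ j, (a j).totalDegree ≤ c * (2 * j + 1) := by
    intro j
    induction j using Nat.strong_induction_on with
    | _ j ih =>
      rcases j with _ | k
      · simp only [a, rootCoeff]
        omega
      · simp only [a]
        rw [rootCoeff]
        refine (MvPolynomial.totalDegree_add _ _).trans (max_le ?_ ?_)
        · refine (MvPolynomial.totalDegree_mul _ _).trans ?_
          have h1 : (rootCoeff α β γ k).totalDegree ≤ c * (2 * k + 1) := ih k (by omega)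
          have h2 : β.totalDegree ≤ c := by omega
          nlinarith
        · refine (MvPolynomial.totalDegree_mul _ _).trans ?_
          have h2 : γ.totalDegree ≤ c := by omega
          have h3 : (∑ i : Fin (k + 1), rootCoeff α β γ i *
              rootCoeff α β γ (k - i)).totalDegree ≤ c * (2 * k + 2) := by
            refine MvPolynomial.totalDegree_finsetSum_le fun i _ => ?_
            refine (MvPolynomial.totalDegree_mul _ _).trans ?_
            have h4 : (rootCoeff α β γ i).totalDegree ≤ c * (2 * i + 1) := ih i (by omega)
            have h5 : (rootCoeff α β γ (k - i)).totalDegree ≤ c * (2 * (k - i) + 1) :=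
              ih (k - i) (by omega)
            have h6 : c * (2 * k + 2) = c * (2 * i + 1) + c * (2 * (k - i) + 1) := by
              rw [← mul_add]
              congr 1
              omega
            omega
          nlinarith
  have hroot : PowerSeries.mk a = PowerSeries.C α + PowerSeries.X *
      (PowerSeries.C β * PowerSeries.mk a + PowerSeries.C γ * PowerSeries.mk a ^ 2) := by
    ext1 N
    rcases N with _ | k
    · simp [a, rootCoeff]
    · rw [map_add, PowerSeries.coeff_succ_X_mul, map_add, PowerSeries.coeff_C_mul,
        PowerSeries.coeff_C_mul, PowerSeries.coeff_C, if_neg (by omega), zero_add, sq,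
        PowerSeries.coeff_mul, PowerSeries.coeff_mk, PowerSeries.coeff_mk,
        Finset.Nat.sum_antidiagonal_eq_sum_range_succ_mk, Finset.sum_range]
      simp only [a, PowerSeries.coeff_mk]
      rw [rootCoeff]
  refine ⟨⟨_, PowerSeries.mk a, ⟨2 * c, fun j => ?_⟩, rfl⟩, ?_⟩
  · rw [PowerSeries.coeff_mk]
    exact (ha j).trans (by nlinarith)
  · have h := congrArg (seriesSum x) hroot
    simp only [map_add, map_mul, map_pow, seriesSum_X, seriesSum_C] at h
    apply Subtype.ext
    have e2 : ((2 : weakCompletion R x) : TwoAdic A) = 2 := rfl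
    simp only [Subalgebra.coe_add, Subalgebra.coe_mul, Subalgebra.coe_pow, e2, coe_ofPoly]
    exact h

/-- An element of `A^†` congruent to `1` modulo `2` is not a zero divisor. -/
theorem eq_zero_of_eq_two_mul (x : Fin n → A) (z s : weakCompletion R x) (h : z = 2 * s * z) :
    z = 0 := by
  refine eq_zero_of_forall_two_pow x z fun m => ⟨s ^ m * z, ?_⟩
  induction m with
  | zero => simp
  | succ m ih =>
    rw [pow_succ, pow_succ]
    linear_combination ih + 2 ^ m * s ^ m * h

end WeakCompletion
section Curve

set_option linter.unusedSectionVars false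

/-- The lifted data defining the family `Y² + hY = f`. Here `WittVector 2 k = ℤ_q` for the finite
field `k = 𝔽_q`, and `Polynomial (Polynomial _)` is `ℤ_q[Γ][X]`. -/
structure CurveData (k : Type*) [Field k] [CharP k 2] where
  /-- the number of factors of `H` -/
  numFactors : ℕ
  /-- the leading coefficient of `h` -/
  c : (WittVector 2 k)ˣ
  /-- the factors `h_i` -/
  factor : Fin numFactors → Polynomial (Polynomial (WittVector 2 k))
  /-- the multiplicities `r_i` -/
  mult : Fin numFactors → ℕ
  /-- the cofactor `Q_f` of `H` in `f` -/
  Qf : Polynomial (Polynomial (WittVector 2 k))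

variable {k : Type*} [Field k] [CharP k 2]

namespace CurveData

/-- `H = ∏ h_i`. -/
def H (D : CurveData k) : Polynomial (Polynomial (WittVector 2 k)) := ∏ i, D.factor i

/-- `h = c ∏ h_i ^ r_i`. -/
def h (D : CurveData k) : Polynomial (Polynomial (WittVector 2 k)) :=
  Polynomial.C (Polynomial.C (D.c : WittVector 2 k)) * ∏ i, D.factor i ^ D.mult i

/-- `f = H Q_f`. -/
def f (D : CurveData k) : Polynomial (Polynomial (WittVector 2 k)) := D.H * D.Qf

/-- `r(Γ) = Res_X(H, Q_f ∂H/∂X)`. -/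
def r (D : CurveData k) : Polynomial (WittVector 2 k) :=
  D.H.resultant (D.Qf * D.H.derivative)

/-- The requirements on the lifted data, for curves of genus `g`. -/
structure IsAdmissible (D : CurveData k) (g : ℕ) : Prop where
  one_le_genus : 1 ≤ g
  mult_pos : ∀ i, 0 < D.mult i
  factor_monic : ∀ i, (D.factor i).Monic
  Qf_monic : D.Qf.Monic
  natDegree_f : D.f.natDegree = 2 * g + 1
  natDegree_h : D.h.natDegree ≤ g
  r_zero : ¬ (2 : WittVector 2 k) ∣ D.r.eval 0

/-- The inclusion of `ℤ_q[Γ][X]` in `ℤ_q[Γ, X, Y, R, Z]`; the five variables are numbered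
`0, …, 4` in this order. -/
def toMv : Polynomial (Polynomial (WittVector 2 k)) →+* MvPolynomial (Fin 5) (WittVector 2 k) :=
  Polynomial.eval₂RingHom (Polynomial.aeval (MvPolynomial.X 0)).toRingHom (MvPolynomial.X 1)

/-- The relations `R r(Γ) = 1`, `Z H(X, Γ) = 1` and `Y² + h(X, Γ) Y - f(X, Γ) = 0`. -/
def relations (D : CurveData k) : Ideal (MvPolynomial (Fin 5) (WittVector 2 k)) :=
  Ideal.span {MvPolynomial.X 3 * toMv (Polynomial.C D.r) - 1, MvPolynomial.X 4 * toMv D.H - 1,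
    MvPolynomial.X 2 ^ 2 + toMv D.h * MvPolynomial.X 2 - toMv D.f}

/-- The ring `ℤ_q[Γ, X, Y, 1/r(Γ), 1/H(X, Γ)] / (Y² + hY - f)`. -/
abbrev CoordRing (D : CurveData k) : Type _ :=
  MvPolynomial (Fin 5) (WittVector 2 k) ⧸ D.relations

/-- The generators `Γ, X, Y, 1/r, 1/H` of the coordinate ring. -/
def gens (D : CurveData k) (i : Fin 5) : D.CoordRing :=
  Ideal.Quotient.mk D.relations (MvPolynomial.X i)

/-- The integral dagger algebra `ℤ_q[Γ, X, Y, 1/r, 1/H]^† / (Y² + hY - f)`. -/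
abbrev Dagger (D : CurveData k) : Type _ := weakCompletion (WittVector 2 k) D.gens

/-- The element of the dagger algebra given by a polynomial in `Γ, X, Y, 1/r, 1/H`. -/
abbrev ofMv (D : CurveData k) :
    MvPolynomial (Fin 5) (WittVector 2 k) →ₐ[WittVector 2 k] D.Dagger :=
  ofPoly (WittVector 2 k) D.gens

/-- The element `Γ`. -/
def gam (D : CurveData k) : D.Dagger := D.ofMv (MvPolynomial.X 0)

/-- The element `X`. -/
def xx (D : CurveData k) : D.Dagger := D.ofMv (MvPolynomial.X 1)

/-- The element `Y`. -/
def yy (D : CurveData k) : D.Dagger := D.ofMv (MvPolynomial.X 2)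

/-- The element `P(X, Γ)`, for a polynomial `P ∈ ℤ_q[Γ][X]`. -/
def ofXGam (D : CurveData k) (P : Polynomial (Polynomial (WittVector 2 k))) : D.Dagger :=
  D.ofMv (toMv P)

theorem toMv_C_C (a : WittVector 2 k) :
    toMv (Polynomial.C (Polynomial.C a)) = MvPolynomial.C a := by
  simp [toMv, MvPolynomial.algebraMap_eq]

theorem toMv_C_X : toMv (Polynomial.C (Polynomial.X : Polynomial (WittVector 2 k))) =
    MvPolynomial.X 0 := by
  simp [toMv]

theorem toMv_X : toMv (Polynomial.X : Polynomial (Polynomial (WittVector 2 k))) =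
    MvPolynomial.X 1 := by
  simp [toMv]

theorem ofMv_C (D : CurveData k) (a : WittVector 2 k) :
    D.ofMv (MvPolynomial.C a) = algebraMap _ _ a :=
  D.ofMv.commutes a

/-- Ring homomorphisms on the dagger algebra that agree on `ℤ_q`, `Γ` and `X` agree on
`ℤ_q[Γ][X]`. -/
theorem ringHom_ofXGam (D : CurveData k) {F G : D.Dagger →+* D.Dagger}
    (h0 : ∀ a : WittVector 2 k, F (algebraMap _ _ a) = G (algebraMap _ _ a))
    (h1 : F D.gam = G D.gam) (h2 : F D.xx = G D.xx) (P) :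
    F (D.ofXGam P) = G (D.ofXGam P) := by
  have : ((F.comp D.ofMv.toRingHom).comp toMv) = ((G.comp D.ofMv.toRingHom).comp toMv) := by
    refine Polynomial.ringHom_ext' (Polynomial.ringHom_ext (fun a => ?_) ?_) ?_
    · change F (D.ofMv (toMv _)) = G (D.ofMv (toMv _))
      rw [toMv_C_C, ofMv_C, h0]
    · change F (D.ofMv (toMv _)) = G (D.ofMv (toMv _))
      rw [toMv_C_X]
      exact h1
    · change F (D.ofMv (toMv _)) = G (D.ofMv (toMv _))
      rw [toMv_X]
      exact h2
  exact DFunLike.congr_fun this P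

theorem aeval_gens (D : CurveData k) (p : MvPolynomial (Fin 5) (WittVector 2 k)) :
    MvPolynomial.aeval D.gens p = Ideal.Quotient.mk D.relations p := by
  have : MvPolynomial.aeval D.gens = Ideal.Quotient.mkₐ (WittVector 2 k) D.relations := by
    ext i
    simp [gens]
  rw [this]
  rfl

theorem aeval_gens_surjective (D : CurveData k) :
    Function.Surjective (MvPolynomial.aeval D.gens :
      MvPolynomial (Fin 5) (WittVector 2 k) →ₐ[WittVector 2 k] D.CoordRing) := by
  intro a
  obtain ⟨p, rfl⟩ := Ideal.Quotient.mk_surjective a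
  exact ⟨p, D.aeval_gens p⟩

theorem aeval_gens_eq_zero (D : CurveData k) {p : MvPolynomial (Fin 5) (WittVector 2 k)} :
    MvPolynomial.aeval D.gens p = 0 ↔ p ∈ D.relations := by
  rw [aeval_gens, Ideal.Quotient.eq_zero_iff_mem]

theorem ofMv_eq_zero (D : CurveData k) {p : MvPolynomial (Fin 5) (WittVector 2 k)}
    (hp : p ∈ D.relations) : D.ofMv p = 0 :=
  Subtype.ext (by rw [coe_ofPoly, D.aeval_gens_eq_zero.2 hp, map_zero]; rfl)

theorem rinv_mul (D : CurveData k) :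
    D.ofMv (MvPolynomial.X 3) * D.ofXGam (Polynomial.C D.r) = 1 := by
  have := D.ofMv_eq_zero (p := MvPolynomial.X 3 * toMv (Polynomial.C D.r) - 1)
    (Ideal.subset_span (by simp))
  rwa [map_sub, map_mul, map_one, sub_eq_zero] at this

theorem hinv_mul (D : CurveData k) : D.ofMv (MvPolynomial.X 4) * D.ofXGam D.H = 1 := by
  have := D.ofMv_eq_zero (p := MvPolynomial.X 4 * toMv D.H - 1) (Ideal.subset_span (by simp))
  rwa [map_sub, map_mul, map_one, sub_eq_zero] at this

theorem yy_equation (D : CurveData k) :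
    D.yy ^ 2 + D.ofXGam D.h * D.yy - D.ofXGam D.f = 0 := by
  have := D.ofMv_eq_zero (p := MvPolynomial.X 2 ^ 2 + toMv D.h * MvPolynomial.X 2 - toMv D.f)
    (Ideal.subset_span (by simp))
  rwa [map_sub, map_add, map_mul, map_pow] at this

/-- `h` is invertible in the coordinate ring. -/
theorem exists_h_inv (D : CurveData k) : ∃ q, D.ofMv q * D.ofXGam D.h = 1 := by
  let π := Ideal.Quotient.mk D.relations
  have hH : IsUnit (π (toMv D.H)) := by
    refine IsUnit.of_mul_eq_one_right (π (MvPolynomial.X 4)) ?_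
    rw [← map_mul, ← map_one π, Ideal.Quotient.eq]
    exact Ideal.subset_span (by simp)
  have hf : ∀ i, IsUnit (π (toMv (D.factor i))) := fun i => by
    refine isUnit_of_dvd_unit ?_ hH
    exact map_dvd π (map_dvd toMv (Finset.dvd_prod_of_mem _ (Finset.mem_univ i)))
  have hh : IsUnit (π (toMv D.h)) := by
    rw [h, map_mul, map_mul]
    refine IsUnit.mul ?_ ?_
    · exact (((D.c.isUnit.map Polynomial.C).map Polynomial.C).map toMv).map π
    · rw [map_prod, map_prod]
      refine IsUnit.prod_univ_iff.2 fun i => ?_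
      rw [map_pow, map_pow]
      exact (hf i).pow _
  obtain ⟨b, hb⟩ := hh.exists_left_inv
  obtain ⟨q, rfl⟩ := Ideal.Quotient.mk_surjective b
  refine ⟨q, ?_⟩
  have : q * toMv D.h - 1 ∈ D.relations := by
    rw [← Ideal.Quotient.eq, map_mul, map_one]
    exact hb
  have := D.ofMv_eq_zero this
  rwa [map_sub, map_mul, map_one, sub_eq_zero] at this

theorem ringHom_ext (D : CurveData k) {F G : D.Dagger →+* D.Dagger}
    (h0 : ∀ a : WittVector 2 k, F (algebraMap _ _ a) = G (algebraMap _ _ a))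
    (h1 : F D.gam = G D.gam) (h2 : F D.xx = G D.xx) (h3 : F D.yy = G D.yy) : F = G := by
  have hP := D.ringHom_ofXGam h0 h1 h2
  have hinv : ∀ (u v : D.Dagger), u * v = 1 → F v = G v → F u = G u := by
    intro u v huv hv
    have hF : F u * F v = 1 := by rw [← map_mul, huv, map_one]
    have hG : G u * G v = 1 := by rw [← map_mul, huv, map_one]
    rw [hv] at hF
    linear_combination -F u * hG + G u * hF
  refine ringHom_ext_of_ofPoly D.gens fun p => ?_
  have : (F.comp D.ofMv.toRingHom) = (G.comp D.ofMv.toRingHom) := by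
    refine MvPolynomial.ringHom_ext (fun a => ?_) (fun i => ?_)
    · change F (D.ofMv _) = G (D.ofMv _)
      rw [ofMv_C, h0]
    · change F (D.ofMv _) = G (D.ofMv _)
      fin_cases i
      · exact h1
      · exact h2
      · exact h3
      · exact hinv _ _ D.rinv_mul (hP _)
      · exact hinv _ _ D.hinv_mul (hP _)
  exact DFunLike.congr_fun this p

theorem eval₂_eq_zero (D : CurveData k) (ψ : WittVector 2 k →+* WittVector 2 k)
    (y : Fin 5 → D.Dagger)
    (h3 : y 3 * MvPolynomial.eval₂ ((algebraMap _ D.Dagger).comp ψ) y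
      (toMv (Polynomial.C D.r)) = 1)
    (h4 : y 4 * MvPolynomial.eval₂ ((algebraMap _ D.Dagger).comp ψ) y (toMv D.H) = 1)
    (h2 : y 2 ^ 2 + MvPolynomial.eval₂ ((algebraMap _ D.Dagger).comp ψ) y (toMv D.h) * y 2 -
      MvPolynomial.eval₂ ((algebraMap _ D.Dagger).comp ψ) y (toMv D.f) = 0)
    (p : MvPolynomial (Fin 5) (WittVector 2 k)) (hp : MvPolynomial.aeval D.gens p = 0) :
    MvPolynomial.eval₂ ((algebraMap _ D.Dagger).comp ψ) y p = 0 := by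
  rw [aeval_gens_eq_zero] at hp
  have : D.relations ≤ RingHom.ker
      (MvPolynomial.eval₂Hom ((algebraMap _ D.Dagger).comp ψ) y) := by
    refine Ideal.span_le.2 ?_
    rintro q (rfl | rfl | rfl)
    · simp [RingHom.mem_ker, h3]
    · simp [RingHom.mem_ker, h4]
    · simpa [RingHom.mem_ker] using h2
  exact this hp

/-- The hyperelliptic involution: `Γ ↦ Γ`, `X ↦ X`, `Y ↦ -Y - h(X, Γ)`. -/
structure IsInvolution (D : CurveData k) (F : D.Dagger →ₐ[WittVector 2 k] D.Dagger) : Prop where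
  map_gam : F D.gam = D.gam
  map_xx : F D.xx = D.xx
  map_yy : F D.yy = -D.yy - D.ofXGam D.h

theorem existsUnique_isInvolution (D : CurveData k) : ∃! F, D.IsInvolution F := by
  let y : Fin 5 → D.Dagger := ![D.gam, D.xx, -D.yy - D.ofXGam D.h,
    D.ofMv (MvPolynomial.X 3), D.ofMv (MvPolynomial.X 4)]
  have hP : ∀ P, MvPolynomial.eval₂ ((algebraMap _ D.Dagger).comp (RingHom.id _)) y (toMv P) =
      D.ofXGam P := by
    have : ((MvPolynomial.eval₂Hom ((algebraMap _ D.Dagger).comp (RingHom.id _)) y).comp toMv) =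
        (D.ofMv.toRingHom.comp toMv) := by
      refine Polynomial.ringHom_ext' (Polynomial.ringHom_ext (fun a => ?_) ?_) ?_
      · simp [toMv]
      · simp [toMv, y, gam]
      · simp [toMv, y, xx]
    exact fun P => DFunLike.congr_fun this P
  obtain ⟨F, hF⟩ := exists_ringHom D.gens D.aeval_gens_surjective (RingHom.id _) y
    (D.eval₂_eq_zero _ y (by rw [hP]; exact D.rinv_mul) (by rw [hP]; exact D.hinv_mul) (by
      rw [hP, hP]
      change (-D.yy - D.ofXGam D.h) ^ 2 + _ * (-D.yy - D.ofXGam D.h) - _ = 0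
      linear_combination D.yy_equation))
  refine ⟨{ F with commutes' := ?_ }, ⟨?_, ?_, ?_⟩, ?_⟩
  · intro a
    have := hF (MvPolynomial.C a)
    rw [← MvPolynomial.algebraMap_eq, AlgHom.commutes] at this
    refine this.trans ?_
    simp [MvPolynomial.algebraMap_eq]
  · exact (hF _).trans (by simp [y])
  · exact (hF _).trans (by simp [y])
  · exact (hF _).trans (by simp [y])
  · intro G hG
    refine AlgHom.coe_ringHom_injective (D.ringHom_ext (fun a => ?_) ?_ ?_ ?_)
    · change G _ = F _
      have := hF (MvPolynomial.C a)
      rw [← MvPolynomial.algebraMap_eq, AlgHom.commutes] at this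
      rw [AlgHom.commutes, this]
      simp [MvPolynomial.algebraMap_eq]
    · exact hG.map_gam.trans ((hF _).trans (by simp [y])).symm
    · exact hG.map_xx.trans ((hF _).trans (by simp [y])).symm
    · exact hG.map_yy.trans ((hF _).trans (by simp [y])).symm

/-- The lift `F_2` of Frobenius: `σ` on `ℤ_q`, `Γ ↦ Γ²`, `X ↦ X²`, and `F_2(Y) ≡ Y² mod 2`.
(That `F_2(Y)² + h^σ F_2(Y) - f^σ = 0`, with `h^σ = F_2(h)` and `f^σ = F_2(f)`, follows from
`Y² + hY - f = 0` as `F_2` is a ring homomorphism.) -/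
structure IsFrobeniusLift (D : CurveData k) (F : D.Dagger →+* D.Dagger) : Prop where
  map_algebraMap : ∀ a : WittVector 2 k,
    F (algebraMap _ _ a) = algebraMap _ _ (WittVector.frobenius a)
  map_gam : F D.gam = D.gam ^ 2
  map_xx : F D.xx = D.xx ^ 2
  map_yy : F D.yy - D.yy ^ 2 ∈ Ideal.span {(2 : D.Dagger)}

/-- `P ↦ P^σ(X², Γ²)`. -/
def sigmaMv : Polynomial (Polynomial (WittVector 2 k)) →+*
    MvPolynomial (Fin 5) (WittVector 2 k) :=
  Polynomial.eval₂RingHom (Polynomial.eval₂RingHom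
    (MvPolynomial.C.comp WittVector.frobenius) (MvPolynomial.X 0 ^ 2)) (MvPolynomial.X 1 ^ 2)

theorem exists_frobenius_eq [Finite k] (a : WittVector 2 k) :
    ∃ b, WittVector.frobenius a = a ^ 2 + 2 * b := by
  have h : WittVector.frobenius a - a ^ 2 ∈ Ideal.span {((2 : ℕ) : WittVector 2 k)} := by
    rw [WittVector.mem_span_p_iff_coeff_zero_eq_zero]
    change WittVector.constantCoeff (WittVector.frobenius a - a ^ 2) = 0
    rw [map_sub, map_pow, sub_eq_zero]
    exact WittVector.coeff_frobenius_charP 2 a 0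
  obtain ⟨b, hb⟩ := Ideal.mem_span_singleton.1 h
  refine ⟨b, ?_⟩
  push_cast at hb
  linear_combination hb

theorem sigmaMv_C_C (a : WittVector 2 k) :
    sigmaMv (Polynomial.C (Polynomial.C a)) = MvPolynomial.C (WittVector.frobenius a) := by
  simp only [sigmaMv, Polynomial.coe_eval₂RingHom, Polynomial.eval₂_C, RingHom.comp_apply]

theorem sigmaMv_C_X : sigmaMv (Polynomial.C (Polynomial.X : Polynomial (WittVector 2 k))) =
    MvPolynomial.X 0 ^ 2 := by
  simp only [sigmaMv, Polynomial.coe_eval₂RingHom, Polynomial.eval₂_C, Polynomial.eval₂_X]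

theorem sigmaMv_X : sigmaMv (Polynomial.X : Polynomial (Polynomial (WittVector 2 k))) =
    MvPolynomial.X 1 ^ 2 := by
  simp only [sigmaMv, Polynomial.coe_eval₂RingHom, Polynomial.eval₂_X]

theorem exists_sigmaMv_eq [Finite k] (P : Polynomial (Polynomial (WittVector 2 k))) :
    ∃ t, sigmaMv P = toMv P ^ 2 + 2 * t := by
  induction P using Polynomial.induction_on' with
  | add p q hp hq =>
    obtain ⟨t, ht⟩ := hp
    obtain ⟨u, hu⟩ := hq
    exact ⟨t + u - toMv p * toMv q, by rw [map_add, map_add, ht, hu]; ring⟩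
  | monomial n a =>
    have ha : ∃ t, sigmaMv (Polynomial.C a) = toMv (Polynomial.C a) ^ 2 + 2 * t := by
      induction a using Polynomial.induction_on' with
      | add p q hp hq =>
        obtain ⟨t, ht⟩ := hp
        obtain ⟨u, hu⟩ := hq
        exact ⟨t + u - toMv (Polynomial.C p) * toMv (Polynomial.C q), by
          rw [Polynomial.C_add, map_add, map_add, ht, hu]; ring⟩
      | monomial m b =>
        obtain ⟨w, hw⟩ := exists_frobenius_eq b
        refine ⟨MvPolynomial.C w * (MvPolynomial.X 0 ^ m) ^ 2, ?_⟩
        rw [← Polynomial.C_mul_X_pow_eq_monomial, Polynomial.C_mul, Polynomial.C_pow, map_mul,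
          map_mul, map_pow, map_pow, sigmaMv_C_C, sigmaMv_C_X, toMv_C_C, toMv_C_X, hw, map_add,
          map_mul, map_pow, map_ofNat]
        ring
    obtain ⟨t, ht⟩ := ha
    refine ⟨t * (MvPolynomial.X 1 ^ n) ^ 2, ?_⟩
    rw [← Polynomial.C_mul_X_pow_eq_monomial, map_mul, map_mul, map_pow, map_pow, sigmaMv_X, toMv_X, ht]
    ring

theorem frobenius_identity {S : Type*} [CommRing S] {Q h f a b Y v : S}
    (hY : Y ^ 2 + h * Y - f = 0) (hQ : Q * h = 1)
    (hv : v = -Q ^ 2 * (h ^ 2 * Y ^ 2 - f * h * Y + a * Y ^ 2 - b) +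
      2 * (-Q ^ 2 * (Y ^ 2 + a) * v + -Q ^ 2 * v ^ 2)) :
    (Y ^ 2 + 2 * v) ^ 2 + (h ^ 2 + 2 * a) * (Y ^ 2 + 2 * v) - (f ^ 2 + 2 * b) = 0 := by
  have hq2 : Q ^ 2 * h ^ 2 = 1 := by
    rw [← mul_pow, hQ, one_pow]
  linear_combination (Y ^ 2 - h * Y + f) * hY + 2 * h ^ 2 * hv -
    2 * (h ^ 2 * Y ^ 2 - f * h * Y + a * Y ^ 2 - b + 2 * (Y ^ 2 + a) * v + 2 * v ^ 2) * hq2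

theorem exists_isFrobeniusLift [Finite k] (D : CurveData k) : ∃ F, D.IsFrobeniusLift F := by
  obtain ⟨q, hq⟩ := D.exists_h_inv
  obtain ⟨tr, htr⟩ := exists_sigmaMv_eq (Polynomial.C D.r)
  obtain ⟨tH, htH⟩ := exists_sigmaMv_eq D.H
  obtain ⟨th, hth⟩ := exists_sigmaMv_eq D.h
  obtain ⟨tf, htf⟩ := exists_sigmaMv_eq D.f
  have hY := D.yy_equation
  obtain ⟨v3, hv3⟩ := exists_root D.gens 1 (-tr * MvPolynomial.X 3 ^ 2) 0
  obtain ⟨v4, hv4⟩ := exists_root D.gens 1 (-tH * MvPolynomial.X 4 ^ 2) 0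
  obtain ⟨v, hv⟩ := exists_root D.gens
    (-q ^ 2 * (toMv D.h ^ 2 * MvPolynomial.X 2 ^ 2 - toMv D.f * toMv D.h * MvPolynomial.X 2 +
      th * MvPolynomial.X 2 ^ 2 - tf))
    (-q ^ 2 * (MvPolynomial.X 2 ^ 2 + th)) (-q ^ 2)
  let y : Fin 5 → D.Dagger := ![D.gam ^ 2, D.xx ^ 2, D.yy ^ 2 + 2 * v,
    D.ofMv (MvPolynomial.X 3) ^ 2 * v3, D.ofMv (MvPolynomial.X 4) ^ 2 * v4]
  have hP : ∀ P, MvPolynomial.eval₂ ((algebraMap _ D.Dagger).comp WittVector.frobenius) y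
      (toMv P) = D.ofMv (sigmaMv P) := by
    have : ((MvPolynomial.eval₂Hom ((algebraMap _ D.Dagger).comp
        WittVector.frobenius) y).comp toMv) = (D.ofMv.toRingHom.comp sigmaMv) := by
      refine Polynomial.ringHom_ext' (Polynomial.ringHom_ext (fun a => ?_) ?_) ?_
      · change MvPolynomial.eval₂ _ y (toMv _) = D.ofMv (sigmaMv _)
        rw [toMv_C_C, sigmaMv_C_C, ofMv_C, MvPolynomial.eval₂_C]
        rfl
      · change MvPolynomial.eval₂ _ y (toMv _) = D.ofMv (sigmaMv _)
        rw [toMv_C_X, sigmaMv_C_X, map_pow, MvPolynomial.eval₂_X]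
        rfl
      · change MvPolynomial.eval₂ _ y (toMv _) = D.ofMv (sigmaMv _)
        rw [toMv_X, sigmaMv_X, map_pow, MvPolynomial.eval₂_X]
        rfl
    exact fun P => DFunLike.congr_fun this P
  have h3 : y 3 * MvPolynomial.eval₂ ((algebraMap _ D.Dagger).comp WittVector.frobenius) y
      (toMv (Polynomial.C D.r)) = 1 := by
    rw [hP, htr]
    have h1 := D.rinv_mul
    simp only [map_one, map_zero, map_mul, map_neg, map_pow, map_add, map_ofNat] at hv3 ⊢
    change D.ofMv _ ^ 2 * v3 * (D.ofXGam _ ^ 2 + _) = 1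
    linear_combination hv3 + v3 * (D.ofMv (MvPolynomial.X 3) * D.ofXGam (Polynomial.C D.r) + 1)
        * h1
  have h4 : y 4 * MvPolynomial.eval₂ ((algebraMap _ D.Dagger).comp WittVector.frobenius) y
      (toMv D.H) = 1 := by
    rw [hP, htH]
    have h1 := D.hinv_mul
    simp only [map_one, map_zero, map_mul, map_neg, map_pow, map_add, map_ofNat] at hv4 ⊢
    change D.ofMv _ ^ 2 * v4 * (D.ofXGam _ ^ 2 + _) = 1
    linear_combination hv4 + v4 * (D.ofMv (MvPolynomial.X 4) * D.ofXGam D.H + 1) * h1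
  have h2 : y 2 ^ 2 + MvPolynomial.eval₂ ((algebraMap _ D.Dagger).comp WittVector.frobenius) y
      (toMv D.h) * y 2 - MvPolynomial.eval₂ ((algebraMap _ D.Dagger).comp WittVector.frobenius) y
      (toMv D.f) = 0 := by
    rw [hP, hP, hth, htf]
    simp only [map_sub, map_mul, map_neg, map_pow, map_add, map_ofNat] at hv ⊢
    exact frobenius_identity hY hq hv
  obtain ⟨F, hF⟩ := exists_ringHom D.gens D.aeval_gens_surjective WittVector.frobenius y
    (D.eval₂_eq_zero _ y h3 h4 h2)
  refine ⟨F, fun a => ?_, ?_, ?_, ?_⟩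
  · have := hF (MvPolynomial.C a)
    rw [MvPolynomial.eval₂_C] at this
    rw [← ofMv_C]
    exact this
  · exact (hF _).trans (MvPolynomial.eval₂_X _ _ _)
  · exact (hF _).trans (MvPolynomial.eval₂_X _ _ _)
  · rw [Ideal.mem_span_singleton]
    refine ⟨v, ?_⟩
    rw [sub_eq_iff_eq_add']
    exact (hF _).trans (MvPolynomial.eval₂_X _ _ _)

theorem frobenius_unique_identity {S : Type*} [CommRing S] {Q h a d f Y V Z u w : S}
    (hQ : Q * h = 1) (hd : d = h ^ 2 + 2 * a) (hV : V ^ 2 + d * V - f = 0)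
    (hZ : Z ^ 2 + d * Z - f = 0) (hu : V - Y ^ 2 = 2 * u) (hw : Z - Y ^ 2 = 2 * w) :
    V - Z = 2 * (-Q ^ 2 * (Y ^ 2 + u + w + a)) * (V - Z) := by
  have hq2 : Q ^ 2 * h ^ 2 = 1 := by
    rw [← mul_pow, hQ, one_pow]
  have e1 : (V - Z) * (V + Z + d) = 0 := by linear_combination hV - hZ
  rw [hd] at e1
  linear_combination Q ^ 2 * e1 - (V - Z) * hq2 - Q ^ 2 * (V - Z) * (hu + hw)

theorem IsFrobeniusLift.exists_map_ofXGam [Finite k] {D : CurveData k}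
    {F : D.Dagger →+* D.Dagger} (hF : D.IsFrobeniusLift F) (P) :
    ∃ t, F (D.ofXGam P) = D.ofXGam P ^ 2 + 2 * t := by
  obtain ⟨t, ht⟩ := exists_sigmaMv_eq P
  refine ⟨D.ofMv t, ?_⟩
  have : ((F.comp D.ofMv.toRingHom).comp toMv) = (D.ofMv.toRingHom.comp sigmaMv) := by
    refine Polynomial.ringHom_ext' (Polynomial.ringHom_ext (fun a => ?_) ?_) ?_
    · change F (D.ofMv (toMv _)) = D.ofMv (sigmaMv _)
      rw [toMv_C_C, sigmaMv_C_C, ofMv_C, ofMv_C, hF.map_algebraMap]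
    · change F (D.ofMv (toMv _)) = D.ofMv (sigmaMv _)
      rw [toMv_C_X, sigmaMv_C_X, map_pow]
      exact hF.map_gam
    · change F (D.ofMv (toMv _)) = D.ofMv (sigmaMv _)
      rw [toMv_X, sigmaMv_X, map_pow]
      exact hF.map_xx
  refine (DFunLike.congr_fun this P).trans ?_
  change D.ofMv (sigmaMv P) = _
  rw [ht, map_add, map_mul, map_pow, map_ofNat]
  rfl

theorem IsFrobeniusLift.unique [Finite k] {D : CurveData k} {F G : D.Dagger →+* D.Dagger}
    (hF : D.IsFrobeniusLift F) (hG : D.IsFrobeniusLift G) : G = F := by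
  obtain ⟨q, hq⟩ := D.exists_h_inv
  have h0 : ∀ a : WittVector 2 k, G (algebraMap _ _ a) = F (algebraMap _ _ a) := fun a => by
    rw [hG.map_algebraMap, hF.map_algebraMap]
  have h1 := hG.map_gam.trans hF.map_gam.symm
  have h2 := hG.map_xx.trans hF.map_xx.symm
  have hGP := D.ringHom_ofXGam h0 h1 h2
  refine D.ringHom_ext h0 h1 h2 ?_
  obtain ⟨u, hu⟩ := Ideal.mem_span_singleton.1 hG.map_yy
  obtain ⟨w, hw⟩ := Ideal.mem_span_singleton.1 hF.map_yy
  obtain ⟨t, ht⟩ := hF.exists_map_ofXGam D.h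
  have hGe := congrArg G D.yy_equation
  have hFe := congrArg F D.yy_equation
  rw [map_sub, map_add, map_mul, map_pow, map_zero] at hGe hFe
  rw [hGP, hGP] at hGe
  rw [← sub_eq_zero]
  exact eq_zero_of_eq_two_mul D.gens _ _ (frobenius_unique_identity hq ht hGe hFe hu hw)

theorem existsUnique_isFrobeniusLift [Finite k] (D : CurveData k) :
    ∃! F, D.IsFrobeniusLift F := by
  obtain ⟨F, hF⟩ := D.exists_isFrobeniusLift
  exact ⟨F, hF, fun G hG => hF.unique hG⟩

/-- The derivation `∂/∂X`, with `Y` considered as a function of `X`: the `ℤ_q`-linear derivation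
with `Γ ↦ 0` and `X ↦ 1`. -/
structure IsDerivX (D : CurveData k)
    (E : Derivation (WittVector 2 k) D.Dagger D.Dagger) : Prop where
  map_gam : E D.gam = 0
  map_xx : E D.xx = 1

theorem exists_isDerivX (D : CurveData k) : ∃ E, D.IsDerivX E := by
  obtain ⟨q, hq⟩ := D.exists_h_inv
  obtain ⟨v, hv⟩ := exists_root D.gens 1 (-MvPolynomial.X 2 * q) 0
  have hY := D.yy_equation
  have hu : (D.ofMv q * v) * (2 * D.yy + D.ofXGam D.h) = 1 := by
    simp only [map_one, map_zero, map_mul, map_neg] at hv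
    change v = 1 + 2 * (-D.yy * _ * v + _) at hv
    linear_combination hv + v * hq
  let y : Fin 5 → D.Dagger := ![0, 1,
    D.ofMv q * v * (D.ofXGam D.f.derivative - D.ofXGam D.h.derivative * D.yy), 0,
    -D.ofMv (MvPolynomial.X 4) ^ 2 * D.ofXGam D.H.derivative]
  let δ : MvPolynomial (Fin 5) (WittVector 2 k) → D.Dagger := fun p =>
    ∑ i, D.ofMv (MvPolynomial.pderiv i p) * y i
  have hadd : ∀ p p', δ (p + p') = δ p + δ p' := fun p p' => by
    simp [δ, add_mul, Finset.sum_add_distrib]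
  have hsub : ∀ p p', δ (p - p') = δ p - δ p' := fun p p' => by
    simp [δ, sub_mul, Finset.sum_sub_distrib]
  have hmul : ∀ p p', δ (p * p') = D.ofMv p * δ p' + D.ofMv p' * δ p := fun p p' => by
    simp only [δ, Finset.mul_sum, ← Finset.sum_add_distrib]
    refine Finset.sum_congr rfl fun i _ => ?_
    simp only [Derivation.leibniz, smul_eq_mul, map_add, map_mul]
    ring
  have hX : ∀ i, δ (MvPolynomial.X i) = y i := by
    intro i
    simp only [δ, MvPolynomial.pderiv_X]
    rw [Finset.sum_eq_single i]
    · simp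
    · intro j _ hj
      rw [Pi.single_apply, if_neg (Ne.symm hj), map_zero, zero_mul]
    · simp
  have hC : ∀ a, δ (MvPolynomial.C a) = 0 := by
    intro a
    simp [δ]
  have h1 : δ 1 = 0 := by
    rw [← map_one MvPolynomial.C]
    exact hC 1
  have hG : ∀ a : Polynomial (WittVector 2 k), δ (toMv (Polynomial.C a)) = 0 := by
    intro a
    induction a using Polynomial.induction_on with
    | C a =>
      have : toMv (Polynomial.C (Polynomial.C a)) = MvPolynomial.C a := by
        simp [toMv, MvPolynomial.algebraMap_eq]
      rw [this, hC]
    | add p p' hp hp' => rw [Polynomial.C_add, map_add, hadd, hp, hp', add_zero]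
    | monomial n a ih =>
      have : toMv (Polynomial.C (Polynomial.X : Polynomial (WittVector 2 k))) =
        MvPolynomial.X 0 := by simp [toMv]
      rw [pow_succ, ← mul_assoc, Polynomial.C_mul, map_mul, hmul, ih, this, hX]
      simp [y]
  have hP : ∀ P, δ (toMv P) = D.ofXGam P.derivative := by
    intro P
    induction P using Polynomial.induction_on with
    | C a =>
      rw [hG]
      simp [ofXGam]
    | add p p' hp hp' =>
      rw [map_add, hadd, hp, hp', Polynomial.derivative_add]
      simp [ofXGam]
    | monomial n a ih =>
      have e : toMv (Polynomial.X : Polynomial (Polynomial (WittVector 2 k))) =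
        MvPolynomial.X 1 := by simp [toMv]
      rw [pow_succ, ← mul_assoc, map_mul, hmul, ih, e, hX, Polynomial.derivative_mul (f := _ * _),
        Polynomial.derivative_X]
      simp only [ofXGam, map_add, map_mul, e, mul_one]
      simp only [y, Matrix.cons_val_one, Matrix.cons_val_zero, mul_one]
      ring
  obtain ⟨E, hE⟩ := exists_derivation D.gens D.aeval_gens_surjective y (by
    intro p hp
    rw [aeval_gens_eq_zero] at hp
    suffices δ p = 0 from this
    refine Submodule.span_induction (p := fun p _ => δ p = 0) ?_ ?_ ?_ ?_ hp
    · rintro p (rfl | rfl | rfl)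
      · rw [hsub, hmul, h1, hX, hG]
        simp [y]
      · rw [hsub, hmul, h1, hX, hP]
        have h4 := D.hinv_mul
        change D.ofMv (MvPolynomial.X 4) * _ + D.ofXGam D.H *
          (-D.ofMv (MvPolynomial.X 4) ^ 2 * D.ofXGam D.H.derivative) - 0 = 0
        linear_combination -D.ofMv (MvPolynomial.X 4) * D.ofXGam D.H.derivative * h4
      · rw [hsub, hadd, sq, hmul, hmul, hX, hP, hP]
        change D.yy * (D.ofMv q * v * (D.ofXGam D.f.derivative - D.ofXGam D.h.derivative * D.yy)) +
          D.yy * (D.ofMv q * v * (D.ofXGam D.f.derivative - D.ofXGam D.h.derivative * D.yy)) +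
          (D.ofXGam D.h *
          (D.ofMv q * v * (D.ofXGam D.f.derivative - D.ofXGam D.h.derivative * D.yy)) +
          D.yy * D.ofXGam D.h.derivative) - D.ofXGam D.f.derivative = 0
        linear_combination (D.ofXGam D.f.derivative - D.ofXGam D.h.derivative * D.yy) * hu
    · simp [δ]
    · intro p p' _ _ hp hp'
      rw [hadd, hp, hp', add_zero]
    · intro a p hp' hp
      rw [smul_eq_mul, hmul, hp, D.ofMv_eq_zero hp']
      simp)
  exact ⟨E, (hE _).trans (hX 0), (hE _).trans (hX 1)⟩

theorem derivation_eq_zero {D : CurveData k}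
    (Δ : Derivation (WittVector 2 k) D.Dagger D.Dagger) (d0 : Δ D.gam = 0) (d1 : Δ D.xx = 0) :
    Δ = 0 := by
  obtain ⟨q, hq⟩ := D.exists_h_inv
  have hY := D.yy_equation
  have dC : ∀ a, Δ (algebraMap _ _ a) = 0 := fun a => Δ.map_algebraMap a
  have dG : ∀ a : Polynomial (WittVector 2 k), Δ (D.ofXGam (Polynomial.C a)) = 0 := by
    intro a
    induction a using Polynomial.induction_on with
    | C a =>
      have : D.ofXGam (Polynomial.C (Polynomial.C a)) = algebraMap _ _ a := by
        simp [ofXGam, toMv]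
      rw [this, dC]
    | add p p' hp hp' =>
      have : D.ofXGam (Polynomial.C (p + p')) =
        D.ofXGam (Polynomial.C p) + D.ofXGam (Polynomial.C p') := by simp [ofXGam]
      rw [this, map_add, hp, hp', add_zero]
    | monomial n a ih =>
      have : D.ofXGam (Polynomial.C (Polynomial.C a * Polynomial.X ^ (n + 1))) =
        D.ofXGam (Polynomial.C (Polynomial.C a * Polynomial.X ^ n)) * D.gam := by
        rw [pow_succ, ← mul_assoc, Polynomial.C_mul, ofXGam, map_mul, map_mul, toMv_C_X]
        rfl
      rw [this, Derivation.leibniz, ih, d0, smul_zero, smul_zero, add_zero]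
  have dP : ∀ P, Δ (D.ofXGam P) = 0 := by
    intro P
    induction P using Polynomial.induction_on with
    | C a => exact dG a
    | add p p' hp hp' =>
      have : D.ofXGam (p + p') = D.ofXGam p + D.ofXGam p' := by simp [ofXGam]
      rw [this, map_add, hp, hp', add_zero]
    | monomial n a ih =>
      have : D.ofXGam (Polynomial.C a * Polynomial.X ^ (n + 1)) =
        D.ofXGam (Polynomial.C a * Polynomial.X ^ n) * D.xx := by
        rw [pow_succ, ← mul_assoc, ofXGam, map_mul, map_mul, toMv_X]
        rfl
      rw [this, Derivation.leibniz, ih, d1, smul_zero, smul_zero, add_zero]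
  have dinv : ∀ u w : D.Dagger, u * w = 1 → Δ w = 0 → Δ u = 0 := by
    intro u w huw hw
    have := congrArg Δ huw
    rw [Derivation.leibniz, hw, smul_zero, zero_add, Derivation.map_one_eq_zero,
      smul_eq_mul] at this
    linear_combination u * this - Δ u * huw
  have dY : Δ D.yy = 0 := by
    have h2 := congrArg Δ hY
    rw [sq, map_sub, map_add, Derivation.leibniz, Derivation.leibniz, dP, dP, map_zero] at h2
    simp only [smul_eq_mul, mul_zero, add_zero, sub_zero] at h2
    refine eq_zero_of_eq_two_mul D.gens _ (-D.ofMv q * D.yy) ?_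
    linear_combination D.ofMv q * h2 - Δ D.yy * hq
  have dX : ∀ i, Δ (D.ofMv (MvPolynomial.X i)) = 0 := by
    intro i
    fin_cases i
    · exact d0
    · exact d1
    · exact dY
    · exact dinv _ _ D.rinv_mul (dG _)
    · exact dinv _ _ D.hinv_mul (dP _)
  have dM : ∀ p, Δ (D.ofMv p) = 0 := by
    intro p
    induction p using MvPolynomial.induction_on with
    | C a => exact (congrArg Δ (D.ofMv_C a)).trans (dC a)
    | add p p' hp hp' => rw [map_add, map_add, hp, hp', add_zero]
    | mul_X p i hp =>
      have e : D.ofMv (p * MvPolynomial.X i) = D.ofMv p * D.ofMv (MvPolynomial.X i) :=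
        map_mul D.ofMv _ _
      rw [e]
      generalize D.ofMv p = u at hp ⊢
      have hi := dX i
      generalize D.ofMv (MvPolynomial.X i) = w at hi ⊢
      rw [Derivation.leibniz, hp, hi, smul_zero, smul_zero, add_zero]
  exact derivation_ext_of_ofPoly D.gens fun p => dM p

theorem IsDerivX.unique {D : CurveData k}
    {E E' : Derivation (WittVector 2 k) D.Dagger D.Dagger} (hE : D.IsDerivX E)
    (hE' : D.IsDerivX E') : E' = E := by
  rw [← sub_eq_zero]
  refine derivation_eq_zero _ ?_ ?_
  · rw [Derivation.sub_apply, hE'.map_gam, hE.map_gam, sub_zero]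
  · rw [Derivation.sub_apply, hE'.map_xx, hE.map_xx, sub_self]

theorem existsUnique_isDerivX (D : CurveData k) : ∃! E, D.IsDerivX E := by
  obtain ⟨E, hE⟩ := D.exists_isDerivX
  exact ⟨E, hE, fun E' hE' => hE.unique hE'⟩

/-- The hyperelliptic involution of the integral dagger algebra. -/
def involDagger (D : CurveData k) : D.Dagger →ₐ[WittVector 2 k] D.Dagger :=
  D.existsUnique_isInvolution.choose

/-- The lift of Frobenius `F_2` on the integral dagger algebra. -/
def frobDagger [Finite k] (D : CurveData k) : D.Dagger →+* D.Dagger :=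
  D.existsUnique_isFrobeniusLift.choose

/-- The derivation `∂/∂X` on the integral dagger algebra. -/
def derivDagger (D : CurveData k) : Derivation (WittVector 2 k) D.Dagger D.Dagger :=
  D.existsUnique_isDerivX.choose

theorem involDagger_spec (D : CurveData k) : D.IsInvolution D.involDagger :=
  D.existsUnique_isInvolution.choose_spec.1

theorem frobDagger_spec [Finite k] (D : CurveData k) : D.IsFrobeniusLift D.frobDagger :=
  D.existsUnique_isFrobeniusLift.choose_spec.1

theorem derivDagger_spec (D : CurveData k) : D.IsDerivX D.derivDagger :=
  D.existsUnique_isDerivX.choose_spec.1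

/-- The ring `T = ℚ_q[Γ, X, Y, 1/r, 1/H]^† / (Y² + hY - f)`: the integral dagger algebra with `2`
inverted. A differential form `t dX ∈ T dX` is represented by its coefficient `t ∈ T`. -/
abbrev T (D : CurveData k) : Type _ := Localization.Away (2 : D.Dagger)

instance isLocalizedModule_T (D : CurveData k) :
    IsLocalizedModule (Submonoid.powers (2 : WittVector 2 k))
      (IsScalarTower.toAlgHom (WittVector 2 k) D.Dagger D.T).toLinearMap := by
  rw [isLocalizedModule_iff_isLocalization, Algebra.algebraMapSubmonoid_powers, map_ofNat]
  infer_instance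

theorem powers_two_le (D : CurveData k) (F : D.Dagger →+* D.Dagger) :
    Submonoid.powers (2 : D.Dagger) ≤ (Submonoid.powers (2 : D.Dagger)).comap F := by
  rw [Submonoid.powers_le]
  exact ⟨1, by simp only [pow_one, map_ofNat]⟩

/-- The hyperelliptic involution of `T`. Since it fixes `X`, it acts on `T dX` by
`t dX ↦ invol t dX`. -/
def invol (D : CurveData k) : D.T →ₐ[WittVector 2 k] D.T :=
  { IsLocalization.map D.T (D.involDagger : D.Dagger →+* D.Dagger) (D.powers_two_le _) with
    commutes' := fun a => by
      rw [IsScalarTower.algebraMap_apply (WittVector 2 k) D.Dagger D.T]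
      exact (IsLocalization.map_eq _ _).trans
        (congrArg (algebraMap D.Dagger D.T) (D.involDagger.commutes a)) }

/-- The lift of Frobenius `F_2 : T → T`. -/
def frob [Finite k] (D : CurveData k) : D.T →+* D.T :=
  IsLocalization.map D.T D.frobDagger (D.powers_two_le _)

/-- The differential `d : T → T dX`, `t ↦ (∂t/∂X) dX`. -/
def diff (D : CurveData k) : D.T →ₗ[WittVector 2 k] D.T :=
  IsLocalizedModule.map (Submonoid.powers (2 : WittVector 2 k))
    (IsScalarTower.toAlgHom (WittVector 2 k) D.Dagger D.T).toLinearMap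
    (IsScalarTower.toAlgHom (WittVector 2 k) D.Dagger D.T).toLinearMap
    (D.derivDagger : D.Dagger →ₗ[WittVector 2 k] D.Dagger)

/-- `F_2` on `T dX`, extended from `T` by `dX ↦ 2X dX`: `t dX ↦ F_2(t) 2X dX`. -/
def frobForm [Finite k] (D : CurveData k) (t : D.T) : D.T :=
  D.frob t * (2 * algebraMap D.Dagger D.T D.xx)

/-- The form `ω` is exact: `ω = dt` for some `t ∈ T`. -/
def IsExact (D : CurveData k) (ω : D.T) : Prop := ∃ t, D.diff t = ω

/-- `H_MW = T dX / dT`. -/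
abbrev HMW (D : CurveData k) : Type _ := D.T ⧸ LinearMap.range D.diff

theorem involDagger_involDagger (D : CurveData k) (z : D.Dagger) :
    D.involDagger (D.involDagger z) = z := by
  have hs := D.involDagger_spec
  have hP : D.involDagger (D.ofXGam D.h) = D.ofXGam D.h :=
    D.ringHom_ofXGam (F := (D.involDagger : D.Dagger →+* D.Dagger)) (G := RingHom.id _)
      (fun a => D.involDagger.commutes a) hs.map_gam hs.map_xx D.h
  have : (D.involDagger : D.Dagger →+* D.Dagger).comp D.involDagger = RingHom.id _ := by
    refine D.ringHom_ext (fun a => ?_) ?_ ?_ ?_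
    · change D.involDagger (D.involDagger _) = _
      rw [AlgHom.commutes, AlgHom.commutes]
      rfl
    · change D.involDagger (D.involDagger _) = _
      rw [hs.map_gam, hs.map_gam]
      rfl
    · change D.involDagger (D.involDagger _) = _
      rw [hs.map_xx, hs.map_xx]
      rfl
    · change D.involDagger (D.involDagger _) = D.yy
      rw [hs.map_yy, map_sub, map_neg, hs.map_yy, hP]
      ring
  exact DFunLike.congr_fun this z

theorem derivDagger_involDagger (D : CurveData k) (z : D.Dagger) :
    D.derivDagger (D.involDagger z) = D.involDagger (D.derivDagger z) := by
  let E : Derivation (WittVector 2 k) D.Dagger D.Dagger :=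
    Derivation.mk' (D.involDagger.toLinearMap ∘ₗ
      (D.derivDagger : D.Dagger →ₗ[WittVector 2 k] D.Dagger) ∘ₗ D.involDagger.toLinearMap) (by
      intro a b
      change D.involDagger (D.derivDagger (D.involDagger (a * b))) =
        a * D.involDagger (D.derivDagger (D.involDagger b)) +
        b * D.involDagger (D.derivDagger (D.involDagger a))
      rw [map_mul, Derivation.leibniz]
      simp only [smul_eq_mul, map_add, map_mul, involDagger_involDagger])
  have hE : D.IsDerivX E := by
    refine ⟨?_, ?_⟩
    · change D.involDagger (D.derivDagger (D.involDagger _)) = _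
      rw [D.involDagger_spec.map_gam, D.derivDagger_spec.map_gam, map_zero]
    · change D.involDagger (D.derivDagger (D.involDagger _)) = _
      rw [D.involDagger_spec.map_xx, D.derivDagger_spec.map_xx, map_one]
  have h : D.involDagger (D.derivDagger (D.involDagger z)) = D.derivDagger z :=
    DFunLike.congr_fun (D.derivDagger_spec.unique hE) z
  rw [← h, involDagger_involDagger]

theorem diff_algebraMap (D : CurveData k) (z : D.Dagger) :
    D.diff (algebraMap D.Dagger D.T z) = algebraMap D.Dagger D.T (D.derivDagger z) :=
  IsLocalizedModule.map_apply (Submonoid.powers (2 : WittVector 2 k))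
    (IsScalarTower.toAlgHom (WittVector 2 k) D.Dagger D.T).toLinearMap
    (IsScalarTower.toAlgHom (WittVector 2 k) D.Dagger D.T).toLinearMap
    (D.derivDagger : D.Dagger →ₗ[WittVector 2 k] D.Dagger) z

theorem invol_algebraMap (D : CurveData k) (z : D.Dagger) :
    D.invol (algebraMap D.Dagger D.T z) = algebraMap D.Dagger D.T (D.involDagger z) :=
  IsLocalization.map_eq (Q := D.T) (g := (D.involDagger : D.Dagger →+* D.Dagger))
    (D.powers_two_le _) z

theorem diff_invol (D : CurveData k) (t : D.T) : D.diff (D.invol t) = D.invol (D.diff t) := by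
  have : D.diff ∘ₗ D.invol.toLinearMap = D.invol.toLinearMap ∘ₗ D.diff := by
    refine IsLocalizedModule.linearMap_ext (Submonoid.powers (2 : WittVector 2 k))
      (IsScalarTower.toAlgHom (WittVector 2 k) D.Dagger D.T).toLinearMap
      (IsScalarTower.toAlgHom (WittVector 2 k) D.Dagger D.T).toLinearMap ?_
    refine LinearMap.ext fun z => ?_
    change D.diff (D.invol (algebraMap _ _ z)) = D.invol (D.diff (algebraMap _ _ z))
    rw [invol_algebraMap, diff_algebraMap, diff_algebraMap, invol_algebraMap,
      derivDagger_involDagger]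
  exact LinearMap.congr_fun this t

/-- The action of the hyperelliptic involution on `H_MW`. -/
def involHMW (D : CurveData k) : D.HMW →ₗ[WittVector 2 k] D.HMW :=
  Submodule.mapQ _ _ D.invol.toLinearMap (by
    rintro _ ⟨t, rfl⟩
    exact ⟨D.invol t, D.diff_invol t⟩)

/-- The eigenspace `H_MW^-` of the hyperelliptic involution for the eigenvalue `-1`. -/
def HMWMinus (D : CurveData k) : Submodule (WittVector 2 k) D.HMW :=
  Module.End.eigenspace D.involHMW (-1)

/-- The class of a differential form in `H_MW`. -/
def cls (D : CurveData k) (ω : D.T) : D.HMW := Submodule.Quotient.mk ω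

end CurveData
end Curve
end MonskyWashnitzer

end

namespace MonskyWashnitzer
namespace CurveData

variable {k : Type*} [Field k] [CharP k 2]

/-! Everything follows from the fact that $F_2$ commutes with $d$ and with $\imath$. Commutation
with $\imath$ comes from uniqueness of the Frobenius lift: $\imath F_2\imath$ acts as $F_2$ does on
constants, $\Gamma$ and $X$, and modulo $2$ it sends $Y$ to $-(Y+h)^2-h^2\equiv Y^2$, so it equals
$F_2$; since $\imath^2=1$ this is `involDagger_frobDagger`.

Commutation with $d$ is the chain rule $\partial_X F_2=2X\,F_2\,\partial_X$
(`derivDagger_frobDagger`). The difference of the two sides satisfies a Leibniz rule twisted by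
$F_2$ and kills constants, $\Gamma$ and $X$. Such a map is zero (`derivation_along_eq_zero`):
differentiating the curve equation and using that $h$ is a unit gives $\delta Y\in 2\,T^\circ\delta
Y$, which forces $\delta Y=0$ by $2$-adic separatedness, and density of polynomials does the rest.

After inverting $2$, $F_2$ maps $dT$ into $dT$, so it descends to $H_{MW}$, and the descended map
commutes with $\imath$ and so preserves the eigenspace for $-1$. Finally $\imath(Y)+Y=-h$, so the
form in question is $-F_2(h\,dX)$. The form $h\,dX$ has polynomial coefficient and is integrated
term by term (`isExact_ofXGam`), the denominators $n+1$ being invertible in $T$; as $F_2$ preserves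
exactness, the first claim follows. -/

/-! ### Polynomials in $X$ and $\Gamma$ inside the dagger algebra. -/

theorem ofXGam_add (D : CurveData k) (P Q : Polynomial (Polynomial (WittVector 2 k))) :
    D.ofXGam (P + Q) = D.ofXGam P + D.ofXGam Q := by
  rw [ofXGam, map_add, map_add]
  rfl

theorem ofXGam_mul (D : CurveData k) (P Q : Polynomial (Polynomial (WittVector 2 k))) :
    D.ofXGam (P * Q) = D.ofXGam P * D.ofXGam Q := by
  rw [ofXGam, map_mul, map_mul]
  rfl

theorem ofXGam_X (D : CurveData k) : D.ofXGam Polynomial.X = D.xx := by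
  rw [ofXGam, toMv_X]
  rfl

theorem ofXGam_C_X (D : CurveData k) : D.ofXGam (Polynomial.C Polynomial.X) = D.gam := by
  rw [ofXGam, toMv_C_X]
  rfl

theorem involDagger_ofXGam (D : CurveData k) (P : Polynomial (Polynomial (WittVector 2 k))) :
    D.involDagger (D.ofXGam P) = D.ofXGam P :=
  D.ringHom_ofXGam (F := (D.involDagger : D.Dagger →+* D.Dagger)) (G := RingHom.id _)
    (fun a => D.involDagger.commutes a) D.involDagger_spec.map_gam D.involDagger_spec.map_xx P

/-! ### Frobenius and the hyperelliptic involution on the dagger algebra. -/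

/-- The lift of Frobenius commutes with the hyperelliptic involution on the dagger algebra. -/
theorem involDagger_frobDagger [Finite k] (D : CurveData k) (z : D.Dagger) :
    D.involDagger (D.frobDagger z) = D.frobDagger (D.involDagger z) := by
  have hF := D.frobDagger_spec
  have hi := D.involDagger_spec
  let ι : D.Dagger →+* D.Dagger := D.involDagger
  -- The conjugate $\imath F_2\imath$ is again a lift of Frobenius; only the congruence for $Y$
  -- needs a computation.
  have hG : D.IsFrobeniusLift ((ι.comp D.frobDagger).comp ι) := by
    refine ⟨fun a => ?_, ?_, ?_, ?_⟩
    · change D.involDagger (D.frobDagger (D.involDagger _)) = _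
      rw [AlgHom.commutes, hF.map_algebraMap, AlgHom.commutes]
    · change D.involDagger (D.frobDagger (D.involDagger _)) = _
      rw [hi.map_gam, hF.map_gam, map_pow, hi.map_gam]
    · change D.involDagger (D.frobDagger (D.involDagger _)) = _
      rw [hi.map_xx, hF.map_xx, map_pow, hi.map_xx]
    · obtain ⟨w, hw⟩ := Ideal.mem_span_singleton.1 hF.map_yy
      obtain ⟨t, ht⟩ := hF.exists_map_ofXGam D.h
      have hw' := congrArg D.involDagger hw
      have ht' := congrArg D.involDagger ht
      simp only [map_sub, map_add, map_mul, map_pow, map_ofNat, hi.map_yy,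
        involDagger_ofXGam] at hw' ht'
      rw [Ideal.mem_span_singleton]
      -- With $F_2(Y)=Y^2+2w$ and $F_2(h)=h^2+2t$, the image of $Y$ is
      -- $-(Y+h)^2-2\imath(w)-h^2-2\imath(t)$. Subtracting $Y^2$ and halving gives this witness.
      refine ⟨-D.involDagger w - D.yy ^ 2 - D.yy * D.ofXGam D.h - D.ofXGam D.h ^ 2 -
        D.involDagger t, ?_⟩
      change D.involDagger (D.frobDagger (D.involDagger D.yy)) - _ = _
      rw [hi.map_yy, map_sub, map_neg, map_sub, map_neg]
      linear_combination -hw' - ht'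
  -- Evaluating the equality of lifts at $\imath z$ lets $\imath^2=1$ collapse the inner pair.
  have h : D.involDagger (D.frobDagger (D.involDagger (D.involDagger z))) =
      D.frobDagger (D.involDagger z) := DFunLike.congr_fun (hF.unique hG) (D.involDagger z)
  rwa [involDagger_involDagger] at h

/-! ### Twisted derivations and the chain rule for $F_2$. -/

/-- A derivation along a ring endomorphism `F` of the dagger algebra vanishes if it vanishes on
constants, `Γ` and `X`. -/
theorem derivation_along_eq_zero (D : CurveData k) (F : D.Dagger →+* D.Dagger)
    (δ : D.Dagger →+ D.Dagger) (hmul : ∀ a b, δ (a * b) = F a * δ b + F b * δ a)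
    (hC : ∀ a : WittVector 2 k, δ (algebraMap _ _ a) = 0) (hgam : δ D.gam = 0)
    (hxx : δ D.xx = 0) (z : D.Dagger) : δ z = 0 := by
  obtain ⟨q, hq⟩ := D.exists_h_inv
  have h1 : δ 1 = 0 := by
    rw [← map_one (algebraMap (WittVector 2 k) D.Dagger)]
    exact hC 1
  -- By the twisted Leibniz rule, the polynomials whose image is killed by $\delta$ form a
  -- subalgebra, so it is enough to kill the variables that occur.
  have hM : ∀ p : MvPolynomial (Fin 5) (WittVector 2 k),
      (∀ i ∈ p.vars, δ (D.ofMv (MvPolynomial.X i)) = 0) → δ (D.ofMv p) = 0 := by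
    intro p hp
    have hp' : p ∈ MvPolynomial.supported (WittVector 2 k)
        {i | δ (D.ofMv (MvPolynomial.X i)) = 0} := MvPolynomial.mem_supported.2 hp
    refine Algebra.adjoin_induction (p := fun p _ => δ (D.ofMv p) = 0) ?_ ?_ ?_ ?_ hp'
    · rintro _ ⟨i, hi, rfl⟩
      exact hi
    · intro a
      rw [AlgHom.commutes]
      exact hC a
    · intro p p' _ _ h h'
      rw [map_add, map_add, h, h', add_zero]
    · intro p p' _ _ h h'
      rw [map_mul, hmul, h, h', mul_zero, mul_zero, add_zero]
  have hG : ∀ a : Polynomial (WittVector 2 k), δ (D.ofXGam (Polynomial.C a)) = 0 := by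
    intro a
    induction a using Polynomial.induction_on with
    | C a => rw [ofXGam, toMv_C_C, ofMv_C, hC]
    | add p p' hp hp' => rw [Polynomial.C_add, ofXGam_add, map_add, hp, hp', add_zero]
    | monomial n a ih =>
      rw [pow_succ, ← mul_assoc, Polynomial.C_mul, ofXGam_mul, ofXGam_C_X, hmul, ih, hgam, mul_zero, mul_zero, add_zero]
  have hP : ∀ P, δ (D.ofXGam P) = 0 := by
    intro P
    induction P using Polynomial.induction_on with
    | C a => exact hG a
    | add p p' hp hp' => rw [ofXGam_add, map_add, hp, hp', add_zero]
    | monomial n a ih =>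
      rw [pow_succ, ← mul_assoc, ofXGam_mul, ofXGam_X, hmul, ih, hxx, mul_zero, mul_zero, add_zero]
  -- Applying $\delta$ to $uw=1$ leaves $F(w)\,\delta u=0$, and $F(w)$ is a unit with inverse
  -- $F(u)$. This will handle $1/r$ and $1/H$.
  have hinv : ∀ u w : D.Dagger, u * w = 1 → δ w = 0 → δ u = 0 := by
    intro u w huw hw
    have h := congrArg δ huw
    rw [hmul, hw, mul_zero, zero_add, h1] at h
    have hF := congrArg F huw
    rw [map_mul, map_one] at hF
    linear_combination F u * h - δ u * hF
  have hyy : δ D.yy = 0 := by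
    have h2 := congrArg δ D.yy_equation
    rw [sq, map_sub, map_add, hmul, hmul, hP, hP, map_zero] at h2
    have hqF := congrArg F hq
    rw [map_mul, map_one] at hqF
    -- Applying $\delta$ to $Y^2+hY-f=0$ gives $(2F(Y)+F(h))\,\delta Y=0$. Multiplying by
    -- $F(q)=F(h)^{-1}$ turns this into $\delta Y=2\cdot(-F(q)F(Y))\cdot\delta Y$.
    refine eq_zero_of_eq_two_mul D.gens _ (-F (D.ofMv q) * F D.yy) ?_
    linear_combination F (D.ofMv q) * h2 - δ D.yy * hqF
  have hX : ∀ i, δ (D.ofMv (MvPolynomial.X i)) = 0 := by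
    intro i
    fin_cases i
    · exact hgam
    · exact hxx
    · exact hyy
    · exact hinv _ _ D.rinv_mul (hG _)
    · exact hinv _ _ D.hinv_mul (hP _)
  -- No continuity of $\delta$ is assumed. The Leibniz rule with $\delta(2^m)=0$ gives $\delta(2^m
  -- w)=2^m\delta w$, so polynomial approximation modulo $2^m$ puts $\delta z$ in $2^mT^\circ$ for
  -- every $m$.
  refine eq_zero_of_forall_two_pow D.gens _ fun m => ?_
  obtain ⟨p, w, rfl⟩ := exists_approx D.gens m z
  refine ⟨δ w, ?_⟩
  have e2 : δ (2 ^ m) = 0 := by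
    have h := hC (2 ^ m)
    rwa [map_pow, map_ofNat] at h
  rw [map_add, hM p fun i _ => hX i, zero_add, hmul, e2, mul_zero, add_zero, map_pow, map_ofNat]

/-- The chain rule `∂/∂X (F_2 z) = 2X F_2(∂z/∂X)`. -/
theorem derivDagger_frobDagger [Finite k] (D : CurveData k) (z : D.Dagger) :
    D.derivDagger (D.frobDagger z) = D.frobDagger (D.derivDagger z) * (2 * D.xx) := by
  have hF := D.frobDagger_spec
  have hE := D.derivDagger_spec
  rw [← sub_eq_zero]
  -- The defect of the chain rule. Both of its terms are derivations along $F_2$, hence so is their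
  -- difference.
  let δ : D.Dagger →+ D.Dagger := AddMonoidHom.mk'
    (fun z => D.derivDagger (D.frobDagger z) - D.frobDagger (D.derivDagger z) * (2 * D.xx))
    (fun a b => by simp only [map_add]; ring)
  refine D.derivation_along_eq_zero D.frobDagger δ (fun a b => ?_) (fun a => ?_) ?_ ?_ z
  · simp only [δ, AddMonoidHom.mk'_apply, map_mul, Derivation.leibniz, smul_eq_mul, map_add]
    ring
  · simp only [δ, AddMonoidHom.mk'_apply, hF.map_algebraMap, Derivation.map_algebraMap, map_zero,
      zero_mul, sub_zero]
  · simp only [δ, AddMonoidHom.mk'_apply, hF.map_gam, hE.map_gam, sq, Derivation.leibniz,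
      smul_zero, add_zero, map_zero, zero_mul, sub_zero]
  -- Here the factor $2X$ is forced: $\partial_X(X^2)=2X=F_2(1)\cdot 2X$.
  · simp only [δ, AddMonoidHom.mk'_apply, hF.map_xx, hE.map_xx, sq, Derivation.leibniz,
      smul_eq_mul, map_one]
    ring

/-- Needed to integrate polynomial forms explicitly: on $\mathbb{Z}_q[\Gamma][X]$ the abstractly
chosen derivation is determined by its values on constants, $\Gamma$ and $X$. -/
theorem derivDagger_ofXGam (D : CurveData k) (P : Polynomial (Polynomial (WittVector 2 k))) :
    D.derivDagger (D.ofXGam P) = D.ofXGam P.derivative := by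
  have hE := D.derivDagger_spec
  have hG : ∀ a : Polynomial (WittVector 2 k),
      D.derivDagger (D.ofXGam (Polynomial.C a)) = 0 := by
    intro a
    induction a using Polynomial.induction_on with
    | C a => rw [ofXGam, toMv_C_C, ofMv_C, Derivation.map_algebraMap]
    | add p p' hp hp' => rw [Polynomial.C_add, ofXGam_add, map_add, hp, hp', add_zero]
    | monomial n a ih =>
      rw [pow_succ, ← mul_assoc, Polynomial.C_mul, ofXGam_mul, ofXGam_C_X, Derivation.leibniz, ih, hE.map_gam, smul_zero, smul_zero, add_zero]
  induction P using Polynomial.induction_on with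
  | C a => rw [hG, Polynomial.derivative_C, ofXGam, map_zero, map_zero]
  | add p p' hp hp' => rw [ofXGam_add, map_add, hp, hp', Polynomial.derivative_add, ofXGam_add]
  | monomial n a ih =>
    rw [pow_succ, ← mul_assoc, ofXGam_mul, Derivation.leibniz, ih, ofXGam_X, hE.map_xx,
      Polynomial.derivative_mul (f := _ * _), Polynomial.derivative_X, mul_one, ofXGam_add,
      ofXGam_mul _ (Polynomial.derivative _), ofXGam_X, smul_eq_mul, smul_eq_mul]
    ring

/-! ### Passage from the dagger algebra to $T$, where $2$ is invertible. -/

theorem frob_algebraMap [Finite k] (D : CurveData k) (z : D.Dagger) :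
    D.frob (algebraMap D.Dagger D.T z) = algebraMap D.Dagger D.T (D.frobDagger z) :=
  IsLocalization.map_eq (Q := D.T) (g := D.frobDagger) (D.powers_two_le _) z

theorem isUnit_two_T (D : CurveData k) : IsUnit (2 : D.T) := by
  have h := IsLocalization.Away.algebraMap_isUnit (S := D.T) (2 : D.Dagger)
  rwa [map_ofNat] at h

/-- Clears denominators, so that identities in $T$ can be tested on the dagger algebra even when the
maps involved are neither $\mathbb{Z}_q$-linear nor ring homomorphisms. -/
theorem exists_two_pow_mul_eq (D : CurveData k) (t : D.T) :
    ∃ (n : ℕ) (z : D.Dagger), 2 ^ n * t = algebraMap D.Dagger D.T z := by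
  obtain ⟨n, z, h⟩ := IsLocalization.Away.surj (2 : D.Dagger) t
  refine ⟨n, z, ?_⟩
  rw [← h, map_ofNat, mul_comm]

theorem diff_two_pow_mul (D : CurveData k) (n : ℕ) (t : D.T) :
    D.diff (2 ^ n * t) = 2 ^ n * D.diff t := by
  -- Powers of $2$ are scalars from $\mathbb{Z}_q$, so linearity of `diff` suffices and no Leibniz
  -- rule on $T$ is required.
  have h : ∀ s : D.T, 2 ^ n * s = (2 ^ n : WittVector 2 k) • s := fun s => by
    rw [Algebra.smul_def, map_pow, map_ofNat]
  rw [h, h, map_smul]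

/-- The lift of Frobenius commutes with the differential. -/
theorem diff_frob [Finite k] (D : CurveData k) (t : D.T) :
    D.diff (D.frob t) = D.frobForm (D.diff t) := by
  obtain ⟨n, z, hz⟩ := D.exists_two_pow_mul_eq t
  -- Both sides commute with multiplication by $2^n$, because $F_2$ fixes $2$; after scaling, $t$
  -- comes from the dagger algebra, where the chain rule applies.
  refine (D.isUnit_two_T.pow n).mul_left_cancel ?_
  have h1 : (2 : D.T) ^ n * D.frob t = D.frob (2 ^ n * t) := by rw [map_mul, map_pow, map_ofNat]
  have h2 : (2 : D.T) ^ n * D.frobForm (D.diff t) = D.frobForm (2 ^ n * D.diff t) := by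
    rw [frobForm, frobForm, map_mul, map_pow, map_ofNat, mul_assoc]
  rw [← diff_two_pow_mul, h1, h2, ← diff_two_pow_mul, hz, frob_algebraMap, diff_algebraMap,
    diff_algebraMap, derivDagger_frobDagger, frobForm, frob_algebraMap, map_mul, map_mul,
    map_ofNat]

/-- The lift of Frobenius commutes with the hyperelliptic involution on `T`. -/
theorem invol_frob [Finite k] (D : CurveData k) (t : D.T) :
    D.invol (D.frob t) = D.frob (D.invol t) := by
  have : (D.invol : D.T →+* D.T).comp D.frob = D.frob.comp (D.invol : D.T →+* D.T) := by
    refine IsLocalization.ringHom_ext (Submonoid.powers (2 : D.Dagger)) (RingHom.ext fun z => ?_)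
    change D.invol (D.frob (algebraMap _ _ z)) = D.frob (D.invol (algebraMap _ _ z))
    rw [frob_algebraMap, invol_algebraMap, invol_algebraMap, frob_algebraMap,
      involDagger_frobDagger]
  exact DFunLike.congr_fun this t

/-- The lift of Frobenius commutes with the hyperelliptic involution on `T dX`. -/
theorem invol_frobForm [Finite k] (D : CurveData k) (t : D.T) :
    D.invol (D.frobForm t) = D.frobForm (D.invol t) := by
  -- The factor $2X$ coming from $dX$ is fixed by $\imath$, so the statement on functions carries
  -- over to forms.
  rw [frobForm, frobForm, map_mul, invol_frob, map_mul, map_ofNat, invol_algebraMap,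
    D.involDagger_spec.map_xx]

/-! ### The induced semilinear map on $H_{MW}$ and its eigenspace. -/

theorem frob_smul [Finite k] (D : CurveData k) (a : WittVector 2 k) (t : D.T) :
    D.frob (a • t) = WittVector.frobenius a • D.frob t := by
  rw [Algebra.smul_def, Algebra.smul_def, map_mul,
    IsScalarTower.algebraMap_apply (WittVector 2 k) D.Dagger D.T, frob_algebraMap,
    D.frobDagger_spec.map_algebraMap,
    ← IsScalarTower.algebraMap_apply (WittVector 2 k) D.Dagger D.T]

/-- The action of the lift of Frobenius on `T dX`, as a `σ`-semilinear map. -/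
noncomputable def frobFormₛₗ [Finite k] (D : CurveData k) :
    D.T →ₛₗ[(WittVector.frobenius : WittVector 2 k →+* WittVector 2 k)] D.T where
  toFun := D.frobForm
  map_add' s t := by rw [frobForm, map_add, add_mul]; rfl
  map_smul' a t := by rw [frobForm, frob_smul, smul_mul_assoc]; rfl

/-- The `σ`-semilinear map induced on `H_MW` by the lift of Frobenius. -/
noncomputable def frobHMW [Finite k] (D : CurveData k) :
    D.HMW →ₛₗ[(WittVector.frobenius : WittVector 2 k →+* WittVector 2 k)] D.HMW :=
  Submodule.mapQ _ _ D.frobFormₛₗ (by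
    rintro _ ⟨t, rfl⟩
    -- Well-definedness on the quotient: $F_2(dt)=d(F_2 t)$.
    exact ⟨D.frob t, D.diff_frob t⟩)

theorem frobHMW_cls [Finite k] (D : CurveData k) (ω : D.T) :
    D.frobHMW (D.cls ω) = D.cls (D.frobForm ω) := rfl

theorem frobHMW_involHMW [Finite k] (D : CurveData k) (x : D.HMW) :
    D.frobHMW (D.involHMW x) = D.involHMW (D.frobHMW x) := by
  obtain ⟨ω, rfl⟩ := Submodule.Quotient.mk_surjective _ x
  exact (congrArg D.cls (D.invol_frobForm ω)).symm

/-- Semilinearity does no harm to the eigenspace because the eigenvalue $-1$ is fixed by $\sigma$;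
only additivity and commutation with $\imath$ enter. -/
theorem frobHMW_mem_HMWMinus [Finite k] (D : CurveData k) {x : D.HMW} (hx : x ∈ D.HMWMinus) :
    D.frobHMW x ∈ D.HMWMinus := by
  rw [HMWMinus, Module.End.mem_eigenspace_iff] at hx ⊢
  rw [← frobHMW_involHMW, hx, neg_smul, neg_smul, one_smul, one_smul, map_neg]

/-! ### Exactness of polynomial forms and of the trace of $F_2(Y\,dX)$ under $\imath$. -/

/-- A Witt vector over a field is a unit once its residue is nonzero, and an odd integer is nonzero
in characteristic $2$. -/
theorem isUnit_natCast_of_odd {n : ℕ} (hn : Odd n) : IsUnit (n : WittVector 2 k) := by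
  refine WittVector.isUnit_of_coeff_zero_ne_zero _ ?_
  change WittVector.constantCoeff (n : WittVector 2 k) ≠ 0
  rw [map_natCast, Ne, CharP.cast_eq_zero_iff k 2]
  exact hn.not_two_dvd_nat

theorem IsExact.add {D : CurveData k} {ω η : D.T} (hω : D.IsExact ω) (hη : D.IsExact η) :
    D.IsExact (ω + η) := by
  obtain ⟨s, rfl⟩ := hω
  obtain ⟨t, rfl⟩ := hη
  exact ⟨s + t, map_add _ _ _⟩

/-- Nonzero integers are invertible in `T`, so exactness may be checked up to integer multiples. -/
theorem IsExact.of_natCast_mul {D : CurveData k} {n : ℕ} (hn : n ≠ 0) {ω : D.T}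
    (h : D.IsExact (n * ω)) : D.IsExact ω := by
  obtain ⟨t, ht⟩ := h
  -- The power of $2$ is invertible because $T$ inverts $2$, the odd part because it is already a
  -- unit of $\mathbb{Z}_q$. With $v=1/u$ and $s=1/2^e$, the primitive $t$ of $n\omega$ is divided
  -- by $n$.
  obtain ⟨e, u, hu, rfl⟩ := Nat.exists_eq_two_pow_mul_odd hn
  obtain ⟨v, hv⟩ := (isUnit_natCast_of_odd (k := k) hu).exists_left_inv
  obtain ⟨s, hs⟩ := (D.isUnit_two_T.pow e).exists_right_inv
  refine ⟨v • (s * t), (D.isUnit_two_T.pow e).mul_left_cancel ?_⟩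
  have hv' : algebraMap (WittVector 2 k) D.T v * u = 1 := by
    rw [← map_natCast (algebraMap (WittVector 2 k) D.T), ← map_mul, hv, map_one]
  rw [map_smul, mul_smul_comm, ← diff_two_pow_mul, ← mul_assoc, hs, one_mul, ht,
    Algebra.smul_def]
  push_cast
  linear_combination (2 ^ e * ω) * hv'

/-- The form `P(X, Γ) dX` is exact, for a polynomial `P ∈ ℤ_q[Γ][X]`. -/
theorem isExact_ofXGam (D : CurveData k) (P : Polynomial (Polynomial (WittVector 2 k))) :
    D.IsExact (algebraMap D.Dagger D.T (D.ofXGam P)) := by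
  induction P using Polynomial.induction_on' with
  | add p q hp hq =>
    rw [ofXGam_add, map_add]
    exact hp.add hq
  | monomial n a =>
    -- The monomial $aX^n$, with $a\in\mathbb{Z}_q[\Gamma]$, has primitive $aX^{n+1}/(n+1)$.
    -- Multiplying by $n+1$ first keeps the primitive integral.
    refine IsExact.of_natCast_mul (Nat.succ_ne_zero n)
      ⟨algebraMap _ _ (D.ofXGam (Polynomial.monomial (n + 1) a)), ?_⟩
    rw [diff_algebraMap, derivDagger_ofXGam, Polynomial.derivative_monomial, Nat.add_sub_cancel,
      ← map_natCast (algebraMap D.Dagger D.T), ← map_mul, mul_comm a, ← nsmul_eq_mul, map_nsmul,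
      ofXGam, map_nsmul, map_nsmul, nsmul_eq_mul]
    rfl

theorem IsExact.frobForm [Finite k] {D : CurveData k} {ω : D.T} (h : D.IsExact ω) :
    D.IsExact (D.frobForm ω) := by
  obtain ⟨t, rfl⟩ := h
  exact ⟨D.frob t, D.diff_frob t⟩

/-- The form `ι(F_2(Y dX)) + F_2(Y dX) = -F_2(h dX)` is exact. -/
theorem isExact_invol_frobForm_yy_add [Finite k] (D : CurveData k) :
    D.IsExact (D.invol (D.frobForm (algebraMap D.Dagger D.T D.yy)) +
      D.frobForm (algebraMap D.Dagger D.T D.yy)) := by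
  -- Take a primitive $t$ of $F_2(h\,dX)$. Moving $\imath$ inside $F_2$ turns the sum into
  -- $F_2((\imath Y+Y)\,dX)=-F_2(h\,dX)$, so $-t$ is the required primitive.
  obtain ⟨t, ht⟩ := (D.isExact_ofXGam D.h).frobForm
  refine ⟨-t, ?_⟩
  rw [map_neg, ht, invol_frobForm, invol_algebraMap, D.involDagger_spec.map_yy]
  simp only [frobForm, map_sub, map_neg]
  ring

end CurveData
end MonskyWashnitzer

theorem mainTheorem9 {k : Type*} [Field k] [Finite k] [CharP k 2]
    (D : MonskyWashnitzer.CurveData k) (g : ℕ) (hD : D.IsAdmissible g) :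
    D.IsExact (D.invol (D.frobForm (algebraMap D.Dagger D.T D.yy)) +
      D.frobForm (algebraMap D.Dagger D.T D.yy)) ∧
    ∃ Φ : D.HMW →ₛₗ[(WittVector.frobenius : WittVector 2 k →+* WittVector 2 k)] D.HMW,
      (∀ ω, Φ (D.cls ω) = D.cls (D.frobForm ω)) ∧
      ∀ x ∈ D.HMWMinus, Φ x ∈ D.HMWMinus :=
  ⟨D.isExact_invol_frobForm_yy_add, D.frobHMW, D.frobHMW_cls, fun _ => D.frobHMW_mem_HMWMinus⟩
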